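/- Let $T>0$, $d\in\mathbf N$, and let $\dot W$ be a space-time white noise on $[0,T]\times\mathbf R^d$ over a probability space $(\Omega,\mathcal F,P)$, i.e. a family of jointly Gaussian, mean-zero random variables $\dot W(\xi)=\int\xi\,\dot W\,dx\,dt$, $\xi\in L^2([0,T]\times\mathbf R^d)$, with $\mathbb E[\dot W(\xi)\dot W(\eta)]=\int_{[0,T]\times\mathbf R^d}\xi\eta\,dx\,dt$. Let $W_t(\varphi)=\dot W(1_{[0,t]}\otimes\varphi)\in L^2(\Omega)$, for $t\in[0,T]$ and $\varphi\in L^2(\mathbf R^d)$, be the associated cylindrical Wiener process. Let $\rho:\mathbf R^d\to[0,\infty)$ be $C^\infty$ with compact support, symmetric ($\rho(-x)=\rho(x)$) and with $\int\rho=1$; for $n=1,2,\dots$ put $\rho_n(x)=n^d\rho(nx)$ and $W^{\rho_n}_t(x)=W_t(\rho_n(x-\cdot))$. Then $(W^{\rho_n})$ is a good weak approximation to $W$. That is, there are a filtration $(\mathcal F_t)_{t\in[0,T]}$ and versions of the random variables $W^{\rho_n}_t(x)$ (again denoted $W^{\rho_n}_t(x)$) such that: 1. Each $W^{\rho_n}$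 is a smooth semimartingale: for every $x$, $t\mapsto W^{\rho_n}_t(x)$ is an $(\mathcal F_t)$-semimartingale, and almost surely $W^{\rho_n}_t(x)$ is $C^\infty$ in $x$ for every $t$ and continuous in $t$ for every $x$. 2. For all $n$ and $x$, $(W^{\rho_n}_t(x))_{t\in[0,T]}$ is an $(\mathcal F_t)$-Brownian motion started at $0$ with quadratic variation $\langle W^{\rho_n}(x)\rangle_t=\|\rho\|_{L^2}^2\,n^d\,t$. 3. For all $\varphi\in L^2(\mathbf R^d)$ and $t\in[0,T]$, $$\lim_{n\to\infty}\int_{\mathbf R^d}\varphi(x)\,W^{\rho_n}_t(x)\,dx=W_t(\varphi)\quad\text{in }L^2(\Omega),$$ where the integral over $\mathbf R^d$ is the limit in $L^2(\Omega)$, which exists, of the pathwise Lebesgue integrals over any sequence of bounded measurable sets increasing to $\mathbf R^d$. 4. If moreover $\varphi$ has compact support, then for every $t\in[0,T]$ the integral $\int\varphi(x)W^{\rho_n}_t(x)\,dx$ exists as a Lebesgue integral almost surely for every $n$, and the convergence in 3 holds almost surely. -/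

import Mathlib

open MeasureTheory ProbabilityTheory Filter Topology
open scoped NNReal ENNReal

noncomputable section

namespace CylWiener

/-- The space `ℝ^d` with its Euclidean norm and Lebesgue measure. -/
abbrev Space (d : ℕ) : Type := EuclideanSpace ℝ (Fin d)

/-- The time interval `[0, T]`, as an ordered topological space with least element `0`. -/
abbrev Time (T : ℝ≥0) : Type := Set.Iic T

/-- Lebesgue measure on `[0, T] × ℝ^d`. -/
abbrev spaceTimeMeasure (T : ℝ≥0) (d : ℕ) : Measure (ℝ × Space d) :=
  ((volume : Measure ℝ).restrict (Set.Icc 0 (T : ℝ))).prod (volume : Measure (Space d))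

/-- `L²([0, T] × ℝ^d)`. -/
abbrev SpaceTimeL2 (T : ℝ≥0) (d : ℕ) : Type := Lp ℝ 2 (spaceTimeMeasure T d)

/-- `L²(ℝ^d)`. -/
abbrev SpaceL2 (d : ℕ) : Type := Lp ℝ 2 (volume : Measure (Space d))

/-! ### White noise and the cylindrical Wiener process -/

/-- A space-time white noise on `[0, T] × ℝ^d`: `Wdot ξ` is the random variable
`∫ ξ(t, x) Ẇ(t, x) dx dt`. -/
structure IsSpaceTimeWhiteNoise {Ω : Type*} [MeasurableSpace Ω] (P : Measure Ω) {T : ℝ≥0} {d : ℕ}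
    (Wdot : SpaceTimeL2 T d → Lp ℝ 2 P) : Prop where
  gaussian : IsGaussianProcess (fun ξ ω => Wdot ξ ω) P
  mean_zero : ∀ ξ, ∫ ω, Wdot ξ ω ∂P = 0
  covariance : ∀ ξ η, ∫ ω, Wdot ξ ω * Wdot η ω ∂P
    = ∫ p, ξ p * η p ∂(spaceTimeMeasure T d)

theorem memLp_indicatorTensor {T : ℝ≥0} {d : ℕ} (t : Time T) (φ : SpaceL2 d) :
    MemLp ((Set.Icc 0 ((t : ℝ≥0) : ℝ) ×ˢ Set.univ).indicator fun p : ℝ × Space d => φ p.2) 2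
      (spaceTimeMeasure T d) :=
  ((Lp.memLp φ).comp_snd _).indicator (measurableSet_Icc.prod MeasurableSet.univ)

/-- The function `(s, x) ↦ 1_{[0, t]}(s) φ(x)` as an element of `L²([0, T] × ℝ^d)`. -/
def indicatorTensor {T : ℝ≥0} {d : ℕ} (t : Time T) (φ : SpaceL2 d) : SpaceTimeL2 T d :=
  (memLp_indicatorTensor t φ).toLp _

/-- The cylindrical Wiener process `W_t : L²(ℝ^d) → L²(Ω)` associated to a white noise. -/
def cylindricalWiener {Ω : Type*} [MeasurableSpace Ω] {P : Measure Ω} {T : ℝ≥0} {d : ℕ}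
    (Wdot : SpaceTimeL2 T d → Lp ℝ 2 P) (t : Time T) (φ : SpaceL2 d) : Lp ℝ 2 P :=
  Wdot (indicatorTensor t φ)

/-! ### Semimartingales, Brownian motion, quadratic variation -/

/-- Right-continuous with left limits. -/
def IsCadlag {T : ℝ≥0} (f : Time T → ℝ) : Prop :=
  ∀ t, ContinuousWithinAt f (Set.Ioi t) t ∧ ∃ l, Tendsto f (𝓝[<] t) (𝓝 l)

/-- Local martingales with almost surely càdlàg paths. -/
def IsLocalMartingale {Ω : Type*} {mΩ : MeasurableSpace Ω} (P : Measure Ω) {T : ℝ≥0}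
    (ℱ : Filtration (Time T) mΩ) (M : Time T → Ω → ℝ) : Prop :=
  Locally (fun Y => Martingale Y ℱ P ∧ ∀ᵐ ω ∂P, IsCadlag fun t => Y t ω) ℱ M P

/-- Real semimartingales on `[0, T]`: sums of a local martingale and an adapted càdlàg process of
finite variation. -/
def IsSemimartingale {Ω : Type*} {mΩ : MeasurableSpace Ω} (P : Measure Ω) {T : ℝ≥0}
    (ℱ : Filtration (Time T) mΩ) (X : Time T → Ω → ℝ) : Prop :=
  StronglyAdapted ℱ X ∧
  ∃ M A : Time T → Ω → ℝ,
    IsLocalMartingale P ℱ M ∧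
    StronglyAdapted ℱ A ∧
    (∀ᵐ ω ∂P, IsCadlag (fun t => A t ω) ∧ BoundedVariationOn (fun t => A t ω) Set.univ) ∧
    ∀ᵐ ω ∂P, ∀ t, X t ω = M t ω + A t ω

/-- A random field `S(t, x)` that is a semimartingale in `t` for each `x`, for one and the same
filtration, and that is almost surely `C^∞` in `x` and continuous in `t`. -/
structure IsSmoothSemimartingale {Ω : Type*} {mΩ : MeasurableSpace Ω} (P : Measure Ω) {T : ℝ≥0}
    {d : ℕ} (ℱ : Filtration (Time T) mΩ) (S : Time T → Space d → Ω → ℝ) : Prop where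
  semimartingale : ∀ x, IsSemimartingale P ℱ fun t => S t x
  smooth : ∀ᵐ ω ∂P, (∀ t, ContDiff ℝ (⊤ : ℕ∞) fun x => S t x ω) ∧ ∀ x, Continuous fun t => S t x ω

/-- Brownian motion on `[0, T]` relative to the filtration `ℱ`, with variance `c` per unit of
time. -/
structure IsBrownianMotion {Ω : Type*} {mΩ : MeasurableSpace Ω} (P : Measure Ω) {T : ℝ≥0}
    (ℱ : Filtration (Time T) mΩ) (c : ℝ≥0) (B : Time T → Ω → ℝ) : Prop where
  adapted : StronglyAdapted ℱ B
  start_zero : ∀ᵐ ω ∂P, B ⊥ ω = 0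
  continuous_paths : ∀ᵐ ω ∂P, Continuous fun t => B t ω
  law_increment : ∀ s t, s ≤ t →
    HasLaw (fun ω => B t ω - B s ω) (gaussianReal 0 (c * ((t : ℝ≥0) - (s : ℝ≥0)))) P
  indep_increment : ∀ s t, s ≤ t →
    Indep (MeasurableSpace.comap (fun ω => B t ω - B s ω) inferInstance) (ℱ s) P

/-- `⟨B⟩ = A`: for every `t` and all sequences of partitions `0 = π k 0 ≤ … ≤ π k (N k) = t` with
mesh tending to `0`, the sums of squared increments tend to `A t` in probability. -/
def HasQuadraticVariation {Ω : Type*} [MeasurableSpace Ω] (P : Measure Ω) {T : ℝ≥0}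
    (B A : Time T → Ω → ℝ) : Prop :=
  ∀ (t : Time T) (N : ℕ → ℕ) (π : ℕ → ℕ → Time T),
    (∀ k, Monotone (π k)) → (∀ k, π k 0 = ⊥) → (∀ k, π k (N k) = t) →
    (∀ ε : ℝ, 0 < ε → ∀ᶠ k in atTop, ∀ i < N k, dist (π k (i + 1)) (π k i) ≤ ε) →
    TendstoInMeasure P
      (fun k ω => ∑ i ∈ Finset.range (N k), (B (π k (i + 1)) ω - B (π k i) ω) ^ 2) atTop (A t)

/-! ### Weak approximations -/

/-- `I = ∫ φ(x) Y(x) dx` in `L²(Ω)`. For `φ ∈ L²(ℝ^d)` the integral need not converge absolutely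
for fixed `ω`; it is the limit in `L²(Ω)` of the `ω`-wise Lebesgue integrals over bounded sets
`A k ↑ ℝ^d`, the same for every such exhaustion. -/
def IsSpatialIntegral {Ω : Type*} [MeasurableSpace Ω] (P : Measure Ω) {d : ℕ}
    (φ : Space d → ℝ) (Y : Space d → Ω → ℝ) (I : Ω → ℝ) : Prop :=
  ∀ A : ℕ → Set (Space d), Monotone A → (∀ k, MeasurableSet (A k)) →
    (∀ k, Bornology.IsBounded (A k)) → (⋃ k, A k) = Set.univ →
    (∀ k, ∀ᵐ ω ∂P, IntegrableOn (fun x => φ x * Y x ω) (A k)) ∧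
    (∀ k, MemLp (fun ω => ∫ x in A k, φ x * Y x ω) 2 P) ∧
    Tendsto (fun k => eLpNorm (fun ω => (∫ x in A k, φ x * Y x ω) - I ω) 2 P) atTop (𝓝 0)

/-- The sequence of smooth semimartingales `X n` is a weak approximation to `W`:
`∫ φ(x) X n t x dx → W_t(φ)` in `L²(Ω)` for all `φ ∈ L²(ℝ^d)` and `t ∈ [0, T]`. -/
def IsWeakApproximation {Ω : Type*} {mΩ : MeasurableSpace Ω} {P : Measure Ω} {T : ℝ≥0} {d : ℕ}
    (ℱ : Filtration (Time T) mΩ) (W : Time T → SpaceL2 d → Lp ℝ 2 P)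
    (X : ℕ+ → Time T → Space d → Ω → ℝ) : Prop :=
  (∀ n, IsSmoothSemimartingale P ℱ (X n)) ∧
  ∀ (φ : SpaceL2 d) (t : Time T), ∃ I : ℕ+ → Lp ℝ 2 P,
    (∀ n, IsSpatialIntegral P φ (X n t) (I n)) ∧ Tendsto I atTop (𝓝 (W t φ))

/-- `B` is a Brownian motion with quadratic variation `⟨B⟩_t = c t`. -/
def IsBrownianMotionWithQV {Ω : Type*} {mΩ : MeasurableSpace Ω} (P : Measure Ω) {T : ℝ≥0}
    (ℱ : Filtration (Time T) mΩ) (c : ℝ≥0) (B : Time T → Ω → ℝ) : Prop :=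
  IsBrownianMotion P ℱ c B ∧
  HasQuadraticVariation P B fun t _ => (c : ℝ) * ((t : ℝ≥0) : ℝ)

/-- A weak approximation is good if each `X n · x` is a Brownian motion with quadratic variation
`C n * t`, where `C n` depends on `n` only. -/
def IsGoodWeakApproximation {Ω : Type*} {mΩ : MeasurableSpace Ω} {P : Measure Ω} {T : ℝ≥0}
    {d : ℕ} (ℱ : Filtration (Time T) mΩ) (W : Time T → SpaceL2 d → Lp ℝ 2 P)
    (X : ℕ+ → Time T → Space d → Ω → ℝ) : Prop :=
  IsWeakApproximation ℱ W X ∧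
  ∃ C : ℕ+ → ℝ≥0, ∀ n x, IsBrownianMotionWithQV P ℱ (C n) fun t => X n t x

/-! ### Mollification -/

/-- Nonnegative symmetric smooth kernels with compact support and integral one. -/
structure IsMollifierKernel {d : ℕ} (ρ : Space d → ℝ) : Prop where
  nonneg : ∀ x, 0 ≤ ρ x
  smooth : ContDiff ℝ (⊤ : ℕ∞) ρ
  symm : ∀ x, ρ (-x) = ρ x
  compact_support : HasCompactSupport ρ
  integral_eq_one : ∫ x, ρ x = 1

/-- `ρ_n(x) = n^d ρ(n x)`. -/
def mollifier {d : ℕ} (ρ : Space d → ℝ) (n : ℕ+) (x : Space d) : ℝ :=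
  (n : ℝ) ^ d * ρ ((n : ℝ) • x)

theorem IsMollifierKernel.memLp_translate {d : ℕ} {ρ : Space d → ℝ} (hρ : IsMollifierKernel ρ)
    (n : ℕ+) (x : Space d) : MemLp (fun y => mollifier ρ n (x - y)) 2 volume := by
  have hn : (n : ℝ) ≠ 0 := by exact_mod_cast n.ne_zero
  have hc : Continuous fun y => mollifier ρ n (x - y) := by
    have := hρ.smooth.continuous
    unfold mollifier
    fun_prop
  have h1 : HasCompactSupport (mollifier ρ n) :=
    (hρ.compact_support.comp_homeomorph (Homeomorph.smulOfNeZero (n : ℝ) hn)).mul_left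
  have h2 : HasCompactSupport fun y => mollifier ρ n (x - y) :=
    h1.comp_homeomorph (Homeomorph.subLeft x)
  exact hc.memLp_of_hasCompactSupport h2

/-- `ρ_n(x - ·)` as an element of `L²(ℝ^d)`. -/
def IsMollifierKernel.translate {d : ℕ} {ρ : Space d → ℝ} (hρ : IsMollifierKernel ρ)
    (n : ℕ+) (x : Space d) : SpaceL2 d :=
  (hρ.memLp_translate n x).toLp _

/-- The mollified cylindrical Wiener process `W^{ρ_n}_t(x) = W_t(ρ_n(x - ·))`. -/
def mollifiedWiener {Ω : Type*} [MeasurableSpace Ω] {P : Measure Ω} {T : ℝ≥0} {d : ℕ}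
    (Wdot : SpaceTimeL2 T d → Lp ℝ 2 P) {ρ : Space d → ℝ} (hρ : IsMollifierKernel ρ)
    (n : ℕ+) (t : Time T) (x : Space d) : Lp ℝ 2 P :=
  cylindricalWiener Wdot t (hρ.translate n x)

end CylWiener

end

open CylWiener

/-! The covariance of the white noise makes each $W_t$ a bounded linear map on $L^2(\mathbf R^d)$.
It also gives the Gaussian independent increments, from which the Brownian motion and quadratic
variation claims follow once a version with continuous paths exists. The difficulty is to choose
versions that are regular in $t$ and $x$ together.

$W_t$ is not a random element of $L^2$, but $W_t\circ A$ is one if $A$ is Hilbert–Schmidt: the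
series $\sum_j W_t(Ab_j)\,b_j$ over a Hilbert basis converges, and Kolmogorov's criterion gives a
version $Y_t$ continuous in $t$ for every $\omega$ (`exists_continuous_process`). The operator `A`
has kernel $e(y-z)w(y)$, where $e$ is a product of exponential densities and $w$ a positive weight.
Since $e$ inverts $\prod_i(1+\partial_i)$, every smooth compactly supported $f$ equals $e*k$ with
$k=\prod_i(1+\partial_i)f$, so $f(x-\cdot)=A(v_x)$ with $v_x(y)=k(x-y)/w(y)$ (`smoothing_fieldVec`).
For $f=\rho_n$ the field is $X^n_t(x)=\langle v_x,Y_t\rangle$: continuous in $t$, and smooth in $x$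
because it is a convolution with $k$. One $Y$ serves all $n$, $x$ and $t$.

Integrating over a bounded $B$ gives $\int_B\varphi X^n_t=W_t(\rho_n*(1_B\varphi))$ almost surely,
so the $L^2(\Omega)$ statements reduce to $\rho_n*\varphi\to\varphi$ in $L^2$.

Almost sure convergence needs more. For compactly supported $\varphi$, Plancherel gives
$\|\rho_n*\varphi-\rho_m*\varphi\|^2\le F(n)-F(m)$ for $m\le n$, with $F$ monotone and bounded
(`exists_monotone_control`). Kolmogorov's criterion, applied to the index $n$ with $F$ as clock,
makes $W_t(\rho_n*\varphi)$ almost surely Cauchy. The criterion is therefore proved for an arbitrary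
index set (`exists_version_uniformContinuous`). -/

namespace CylWiener

/-! ### A continuity criterion of Kolmogorov type -/

section Chaining

variable {S : Type*}

/-- The index of the dyadic interval of length `2⁻ᵐ` containing `F s`. -/
noncomputable def dyadicClass (F : S → ℝ) (m : ℕ) (s : S) : ℕ := ⌊2 ^ m * F s⌋₊

/-- A point of `S` in the given dyadic class, if there is one. -/
noncomputable def dyadicRep [Nonempty S] (F : S → ℝ) (m i : ℕ) : S :=
  Classical.epsilon fun s => dyadicClass F m s = i

theorem dyadicClass_rep [Nonempty S] (F : S → ℝ) (m : ℕ) (s : S) :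
    dyadicClass F m (dyadicRep F m (dyadicClass F m s)) = dyadicClass F m s :=
  Classical.epsilon_spec (p := fun t => dyadicClass F m t = dyadicClass F m s) ⟨s, rfl⟩

/-- Dyadic intervals are nested; this is why the parent of class `i` is written `i / 2` in
`chainSum`. -/
theorem dyadicClass_succ_div_two (F : S → ℝ) (m : ℕ) (s : S) :
    dyadicClass F (m + 1) s / 2 = dyadicClass F m s := by
  unfold dyadicClass
  have := Nat.floor_div_natCast (2 ^ (m + 1) * F s) 2
  rw [← this]
  congr 1
  push_cast
  ring

theorem dyadicClass_lt {F : S → ℝ} (hF0 : ∀ s, 0 ≤ F s) (hF1 : ∀ s, F s < 1) (m : ℕ) (s : S) :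
    dyadicClass F m s < 2 ^ m := by
  unfold dyadicClass
  rw [Nat.floor_lt (by have := hF0 s; positivity)]
  push_cast
  have h2 : (0 : ℝ) < 2 ^ m := by positivity
  nlinarith [hF1 s]

theorem abs_sub_le_of_dyadicClass {F : S → ℝ} (hF0 : ∀ s, 0 ≤ F s) {m : ℕ} {s t : S}
    (h1 : dyadicClass F m s ≤ dyadicClass F m t + 1)
    (h2 : dyadicClass F m t ≤ dyadicClass F m s + 1) :
    |F s - F t| ≤ 2 * (1 / 2) ^ m := by
  unfold dyadicClass at h1 h2
  have hp : (0 : ℝ) < 2 ^ m := by positivity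
  have a1 := Nat.floor_le (a := 2 ^ m * F s) (by have := hF0 s; positivity)
  have a2 := Nat.lt_floor_add_one (2 ^ m * F s)
  have b1 := Nat.floor_le (a := 2 ^ m * F t) (by have := hF0 t; positivity)
  have b2 := Nat.lt_floor_add_one (2 ^ m * F t)
  have h1' : ((⌊2 ^ m * F s⌋₊ : ℕ) : ℝ) ≤ (⌊2 ^ m * F t⌋₊ : ℕ) + 1 := by exact_mod_cast h1
  have h2' : ((⌊2 ^ m * F t⌋₊ : ℕ) : ℝ) ≤ (⌊2 ^ m * F s⌋₊ : ℕ) + 1 := by exact_mod_cast h2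
  have key : 2 ^ m * |F s - F t| ≤ 2 := by
    rw [show 2 ^ m * |F s - F t| = |2 ^ m * (F s - F t)| by rw [abs_mul, abs_of_pos hp], abs_le]
    constructor <;> nlinarith
  have : |F s - F t| ≤ 2 / 2 ^ m := by rw [le_div_iff₀ hp]; linarith
  calc |F s - F t| ≤ 2 / 2 ^ m := this
    _ = 2 * (1 / 2) ^ m := by rw [one_div, inv_pow]; rfl

theorem dyadicClass_le_of_abs_sub_lt {F : S → ℝ} (hF0 : ∀ s, 0 ≤ F s) {m : ℕ} {s t : S}
    (h : |F s - F t| < (1 / 2) ^ m) : dyadicClass F m s ≤ dyadicClass F m t + 1 := by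
  unfold dyadicClass
  have hp : (0 : ℝ) < 2 ^ m := by positivity
  have h1 : F s < F t + (1 / 2) ^ m := by linarith [(abs_lt.1 h).2]
  have h2 : 2 ^ m * F s ≤ 2 ^ m * F t + 1 := by
    have : (2 : ℝ) ^ m * (1 / 2) ^ m = 1 := by rw [← mul_pow]; norm_num
    nlinarith
  rw [← Nat.floor_add_one (by have := hF0 t; positivity)]
  exact Nat.floor_le_floor h2

variable {Ω : Type*} {mΩ : MeasurableSpace Ω} {P : Measure Ω}
  {E : Type*} [NormedAddCommGroup E]

/-- The sum of the fourth powers of the increments used by the chaining argument at level `m`. -/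
noncomputable def chainSum [Nonempty S] (F : S → ℝ) (Z : S → Ω → E) (m : ℕ) (ω : Ω) : ℝ≥0∞ :=
  -- Only nonempty classes enter: `dyadicRep` of an empty class is an arbitrary point, whose
  -- increments need not be small.
  open Classical in
  (∑ i ∈ (Finset.range (2 ^ (m + 1))).filter (fun i => ∃ s, dyadicClass F (m + 1) s = i),
    ‖Z (dyadicRep F (m + 1) i) ω - Z (dyadicRep F m (i / 2)) ω‖ₑ ^ 4) +
  ∑ i ∈ (Finset.range (2 ^ m)).filter
      (fun i => (∃ s, dyadicClass F m s = i) ∧ ∃ s, dyadicClass F m s = i + 1),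
    ‖Z (dyadicRep F m (i + 1)) ω - Z (dyadicRep F m i) ω‖ₑ ^ 4

theorem measurable_chainSum [Nonempty S] (F : S → ℝ) {Z : S → Ω → E}
    (hZ : ∀ s, StronglyMeasurable (Z s)) (m : ℕ) : Measurable (chainSum F Z m) := by
  unfold chainSum
  refine Measurable.add (Finset.measurable_sum _ fun i _ => ?_)
    (Finset.measurable_sum _ fun i _ => ?_) <;>
  exact ((hZ _).sub (hZ _)).enorm.pow_const 4

/-- There are at most $2^{m+1}+2^m=3\cdot2^m$ terms, each comparing points with $F$-distance at most
$2\cdot2^{-m}$ and hence of expectation at most $4C\,4^{-m}$. -/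
theorem lintegral_chainSum_le [Nonempty S] {F : S → ℝ} (hF0 : ∀ s, 0 ≤ F s)
    {Z : S → Ω → E} (hZ : ∀ s, StronglyMeasurable (Z s)) {C : ℝ} (hC : 0 ≤ C)
    (hmom : ∀ s t, ∫⁻ ω, ‖Z s ω - Z t ω‖ₑ ^ 4 ∂P ≤ ENNReal.ofReal (C * (F s - F t) ^ 2)) (m : ℕ) :
    ∫⁻ ω, chainSum F Z m ω ∂P ≤ ENNReal.ofReal (12 * C * (1 / 2) ^ m) := by
  classical
  have hm : ∀ s t, Measurable fun ω => ‖Z s ω - Z t ω‖ₑ ^ 4 :=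
    fun s t => ((hZ _).sub (hZ _)).enorm.pow_const 4
  have hb : ∀ s t, |F s - F t| ≤ 2 * (1 / 2) ^ m →
      ∫⁻ ω, ‖Z s ω - Z t ω‖ₑ ^ 4 ∂P ≤ ENNReal.ofReal (4 * C * (1 / 4) ^ m) := by
    intro s t hst
    refine (hmom s t).trans (ENNReal.ofReal_le_ofReal ?_)
    have h1 : (F s - F t) ^ 2 ≤ (2 * (1 / 2) ^ m) ^ 2 := by
      rw [← sq_abs]; gcongr
    have h2 : ((2 : ℝ) * (1 / 2) ^ m) ^ 2 = 4 * (1 / 4) ^ m := by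
      rw [mul_pow, ← pow_mul, mul_comm m, pow_mul]; norm_num
    rw [h2] at h1
    nlinarith
  unfold chainSum
  rw [lintegral_add_left (Finset.measurable_sum _ fun i _ => hm _ _),
    lintegral_finsetSum _ fun i _ => hm _ _, lintegral_finsetSum _ fun i _ => hm _ _]
  have e1 : ∑ i ∈ (Finset.range (2 ^ (m + 1))).filter (fun i => ∃ s, dyadicClass F (m + 1) s = i),
      ∫⁻ ω, ‖Z (dyadicRep F (m + 1) i) ω - Z (dyadicRep F m (i / 2)) ω‖ₑ ^ 4 ∂P
      ≤ (2 ^ (m + 1) : ℕ) • ENNReal.ofReal (4 * C * (1 / 4) ^ m) := by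
    refine (Finset.sum_le_card_nsmul _ _ (ENNReal.ofReal (4 * C * (1 / 4) ^ m)) ?_).trans ?_
    · intro i hi
      obtain ⟨s, rfl⟩ := (Finset.mem_filter.1 hi).2
      refine hb _ _ ?_
      rw [dyadicClass_succ_div_two]
      have key : dyadicClass F m (dyadicRep F (m + 1) (dyadicClass F (m + 1) s))
          = dyadicClass F m (dyadicRep F m (dyadicClass F m s)) := by
        rw [dyadicClass_rep, ← dyadicClass_succ_div_two, dyadicClass_rep, dyadicClass_succ_div_two]
      exact abs_sub_le_of_dyadicClass hF0 (by rw [key]; omega) (by rw [key]; omega)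
    · gcongr
      exact (Finset.card_filter_le _ _).trans (by simp)
  have e2 : ∑ i ∈ (Finset.range (2 ^ m)).filter
      (fun i => (∃ s, dyadicClass F m s = i) ∧ ∃ s, dyadicClass F m s = i + 1),
      ∫⁻ ω, ‖Z (dyadicRep F m (i + 1)) ω - Z (dyadicRep F m i) ω‖ₑ ^ 4 ∂P
      ≤ (2 ^ m : ℕ) • ENNReal.ofReal (4 * C * (1 / 4) ^ m) := by
    refine (Finset.sum_le_card_nsmul _ _ (ENNReal.ofReal (4 * C * (1 / 4) ^ m)) ?_).trans ?_
    · intro i hi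
      obtain ⟨⟨s, hs⟩, ⟨t, ht⟩⟩ := (Finset.mem_filter.1 hi).2
      refine hb _ _ ?_
      have k1 := dyadicClass_rep F m s
      have k2 := dyadicClass_rep F m t
      rw [hs] at k1
      rw [ht] at k2
      exact abs_sub_le_of_dyadicClass hF0 (by rw [k1, k2]) (by rw [k1, k2]; omega)
    · gcongr
      exact (Finset.card_filter_le _ _).trans (by simp)
  refine (add_le_add e1 e2).trans ?_
  rw [nsmul_eq_mul, nsmul_eq_mul, ← add_mul, ← Nat.cast_add, ← ENNReal.ofReal_natCast,
    ← ENNReal.ofReal_mul (by positivity)]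
  refine ENNReal.ofReal_le_ofReal (le_of_eq ?_)
  have : (1 / 4 : ℝ) ^ m = (1 / 2) ^ m * (1 / 2) ^ m := by rw [← mul_pow]; norm_num
  have h3 : (2 : ℝ) ^ m * (1 / 2) ^ m = 1 := by rw [← mul_pow]; norm_num
  push_cast
  rw [this, pow_succ]
  linear_combination 12 * C * (1 / 2) ^ m * h3

theorem ae_tsum_lt_top_of_geometric {f : ℕ → Ω → ℝ≥0∞} (hf : ∀ m, Measurable (f m)) {C r : ℝ}
    (hC : 0 ≤ C) (hr0 : 0 ≤ r) (hr : r < 1)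
    (h : ∀ m, ∫⁻ ω, f m ω ∂P ≤ ENNReal.ofReal (C * r ^ m)) :
    ∀ᵐ ω ∂P, ∑' m, f m ω < ∞ := by
  refine ae_lt_top (Measurable.tsum hf) ?_
  rw [lintegral_tsum fun m => (hf m).aemeasurable]
  refine ne_top_of_le_ne_top ?_ (ENNReal.tsum_le_tsum h)
  rw [← ENNReal.ofReal_tsum_of_nonneg (fun m => by positivity)
    ((summable_geometric_of_lt_one hr0 hr).mul_left C)]
  exact ENNReal.ofReal_ne_top

theorem enorm_rep_succ_le_chainSum [Nonempty S] {F : S → ℝ} (hF0 : ∀ s, 0 ≤ F s)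
    (hF1 : ∀ s, F s < 1) (Z : S → Ω → E) (m : ℕ) (s : S) (ω : Ω) :
    ‖Z (dyadicRep F (m + 1) (dyadicClass F (m + 1) s)) ω
      - Z (dyadicRep F m (dyadicClass F m s)) ω‖ₑ ^ 4 ≤ chainSum F Z m ω := by
  classical
  unfold chainSum
  refine le_trans ?_ le_self_add
  rw [← dyadicClass_succ_div_two F m s]
  refine Finset.single_le_sum
    (f := fun i => ‖Z (dyadicRep F (m + 1) i) ω - Z (dyadicRep F m (i / 2)) ω‖ₑ ^ 4)
    (fun _ _ => zero_le) ?_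
  exact Finset.mem_filter.2 ⟨Finset.mem_range.2 (dyadicClass_lt hF0 hF1 _ _), s, rfl⟩

theorem enorm_rep_adjacent_le_chainSum [Nonempty S] {F : S → ℝ} (hF0 : ∀ s, 0 ≤ F s)
    (hF1 : ∀ s, F s < 1) (Z : S → Ω → E) (m : ℕ) (s t : S) (ω : Ω)
    (h : dyadicClass F m t = dyadicClass F m s + 1) :
    ‖Z (dyadicRep F m (dyadicClass F m t)) ω
      - Z (dyadicRep F m (dyadicClass F m s)) ω‖ₑ ^ 4 ≤ chainSum F Z m ω := by
  classical
  unfold chainSum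
  refine le_trans ?_ le_add_self
  rw [h]
  refine Finset.single_le_sum
    (f := fun i => ‖Z (dyadicRep F m (i + 1)) ω - Z (dyadicRep F m i) ω‖ₑ ^ 4)
    (fun _ _ => zero_le) ?_
  exact Finset.mem_filter.2
    ⟨Finset.mem_range.2 (dyadicClass_lt hF0 hF1 _ _), ⟨s, rfl⟩, ⟨t, h⟩⟩

/-- Each term is at most the sum $A$, and $a^4\le A$ forces $a\le1+A$, which avoids fourth roots. -/
theorem exists_norm_le_geometric_of_tsum_lt_top {f : ℕ → ℝ≥0∞}
    (h : ∑' m, ENNReal.ofReal ((10 / 9) ^ (4 * m)) * f m < ∞) :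
    ∃ M : ℝ, 0 ≤ M ∧ ∀ (m : ℕ) (x : E), ‖x‖ₑ ^ 4 ≤ f m → ‖x‖ ≤ M * (9 / 10) ^ m := by
  set A := ∑' m, ENNReal.ofReal ((10 / 9) ^ (4 * m)) * f m with hA
  refine ⟨1 + A.toReal, by positivity, fun m x hx => ?_⟩
  have h1 : ENNReal.ofReal ((10 / 9) ^ (4 * m)) * ‖x‖ₑ ^ 4 ≤ A :=
    (mul_le_mul_right hx _).trans
      (ENNReal.le_tsum (f := fun m => ENNReal.ofReal ((10 / 9) ^ (4 * m)) * f m) m)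
  have h2 : ((10 / 9) ^ m * ‖x‖) ^ 4 ≤ A.toReal := by
    have := ENNReal.toReal_mono h.ne h1
    rw [ENNReal.toReal_mul, ENNReal.toReal_ofReal (by positivity), ENNReal.toReal_pow,
      toReal_enorm] at this
    rw [mul_pow, ← pow_mul, mul_comm m 4]
    exact this
  have h3 : (10 / 9) ^ m * ‖x‖ ≤ 1 + A.toReal := by
    rcases le_total ((10 / 9) ^ m * ‖x‖) 1 with h | h
    · linarith [ENNReal.toReal_nonneg (a := A)]
    · have := le_self_pow₀ h (n := 4) (by norm_num)
      linarith
  have h4 : ((10 : ℝ) / 9) ^ m * (9 / 10) ^ m = 1 := by rw [← mul_pow]; norm_num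
  calc ‖x‖ = ((10 / 9) ^ m * ‖x‖) * (9 / 10) ^ m := by linear_combination (-‖x‖) * h4
    _ ≤ _ := by gcongr

/-- **Kolmogorov continuity criterion** for processes indexed by an arbitrary set `S`, whose
increments are controlled by a function `F : S → [0, 1)`. -/
theorem exists_version_uniformContinuous [Nonempty S] [CompleteSpace E]
    {F : S → ℝ} (hF0 : ∀ s, 0 ≤ F s)
    (hF1 : ∀ s, F s < 1) {Z : S → Ω → E} (hZ : ∀ s, StronglyMeasurable (Z s)) {C : ℝ} (hC : 0 ≤ C)
    (hmom : ∀ s t, ∫⁻ ω, ‖Z s ω - Z t ω‖ₑ ^ 4 ∂P ≤ ENNReal.ofReal (C * (F s - F t) ^ 2)) :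
    ∃ Y : S → Ω → E, (∀ s, StronglyMeasurable (Y s)) ∧ (∀ s, Y s =ᵐ[P] Z s) ∧
      ∀ ω, ∀ ε > 0, ∃ δ > 0, ∀ s t, |F s - F t| < δ → dist (Y s ω) (Y t ω) < ε := by
  classical
  let w : ℕ → Ω → ℝ≥0∞ := fun m ω => ENNReal.ofReal ((10 / 9) ^ (4 * m)) * chainSum F Z m ω
  have hwm : ∀ m, Measurable (w m) := fun m => (measurable_chainSum F hZ m).const_mul _
  let G : Set Ω := {ω | ∑' m, w m ω < ∞}
  have hGm : MeasurableSet G := measurableSet_lt (Measurable.tsum hwm) measurable_const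
  have hG : ∀ᵐ ω ∂P, ω ∈ G := by
    -- The weights $(10/9)^{4m}$ are affordable because $(10/9)^4/2<1$; their fourth roots produce
    -- the rate $(9/10)^m$ below.
    refine ae_tsum_lt_top_of_geometric hwm (C := 12 * C) (r := (10 / 9) ^ 4 * (1 / 2))
      (by positivity) (by norm_num) (by norm_num) fun m => ?_
    rw [lintegral_const_mul _ (measurable_chainSum F hZ m)]
    refine (mul_le_mul_right (lintegral_chainSum_le hF0 hZ hC hmom m) _).trans ?_
    rw [← ENNReal.ofReal_mul (by positivity)]
    refine ENNReal.ofReal_le_ofReal (le_of_eq ?_)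
    rw [mul_pow, ← pow_mul]
    ring
  let π : ℕ → S → S := fun m s => dyadicRep F m (dyadicClass F m s)
  -- Setting everything to zero off `G` gives regular paths for every `ω`, not just almost every
  -- one.
  let U : ℕ → S → Ω → E := fun m s => G.indicator (Z (π m s))
  have hUm : ∀ m s, StronglyMeasurable (U m s) := fun m s => (hZ _).indicator hGm
  have hbound : ∀ ω, ∃ M : ℝ, 0 ≤ M ∧ (∀ m s, dist (U m s ω) (U (m + 1) s ω) ≤ M * (9 / 10) ^ m) ∧
      ∀ m s t, dyadicClass F m t ≤ dyadicClass F m s + 1 →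
        dyadicClass F m s ≤ dyadicClass F m t + 1 →
        dist (U m s ω) (U m t ω) ≤ M * (9 / 10) ^ m := by
    intro ω
    by_cases hω : ω ∈ G
    · obtain ⟨M, hM0, hM⟩ := exists_norm_le_geometric_of_tsum_lt_top (E := E) hω
      have hU : ∀ m s, U m s ω = Z (π m s) ω := fun m s => Set.indicator_of_mem hω _
      refine ⟨M, hM0, fun m s => ?_, fun m s t h1 h2 => ?_⟩
      · rw [hU, hU, dist_comm, dist_eq_norm]
        exact hM m _ (enorm_rep_succ_le_chainSum hF0 hF1 Z m s ω)
      · rw [hU, hU]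
        rcases Nat.lt_trichotomy (dyadicClass F m s) (dyadicClass F m t) with h | h | h
        · rw [dist_comm, dist_eq_norm]
          exact hM m _ (enorm_rep_adjacent_le_chainSum hF0 hF1 Z m s t ω (by omega))
        · have : π m s = π m t := by simp only [π, h]
          rw [this, dist_self]
          positivity
        · rw [dist_eq_norm]
          exact hM m _ (enorm_rep_adjacent_le_chainSum hF0 hF1 Z m t s ω (by omega))
    · refine ⟨0, le_rfl, fun m s => ?_, fun m s t _ _ => ?_⟩ <;>
      simp [U, Set.indicator_of_notMem hω]
  have hlim : ∀ s ω, ∃ l, Tendsto (fun m => U m s ω) atTop (𝓝 l) := by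
    intro s ω
    obtain ⟨M, -, hM, -⟩ := hbound ω
    exact cauchySeq_tendsto_of_complete
      (cauchySeq_of_le_geometric (9 / 10) M (by norm_num) fun m => hM m s)
  choose Y hY using hlim
  refine ⟨Y, fun s => ?_, fun s => ?_, fun ω ε hε => ?_⟩
  · exact stronglyMeasurable_of_tendsto atTop (fun m => hUm m s)
      (tendsto_pi_nhds.2 fun ω => hY s ω)
  -- The limit `Y s` is identified with `Z s`: the fourth moments of `Z (π m s) - Z s` are summable,
  -- so these differences tend to zero almost surely.
  · have hconv : ∀ᵐ ω ∂P, ∑' m, ‖Z (π m s) ω - Z s ω‖ₑ ^ 4 < ∞ := by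
      refine ae_tsum_lt_top_of_geometric (C := 4 * C) (r := 1 / 4)
        (fun m => ((hZ _).sub (hZ _)).enorm.pow_const 4) (by positivity) (by norm_num)
        (by norm_num) fun m => ?_
      refine (hmom _ _).trans (ENNReal.ofReal_le_ofReal ?_)
      have key : dyadicClass F m (π m s) = dyadicClass F m s := dyadicClass_rep F m s
      have hab := abs_sub_le_of_dyadicClass (s := π m s) (t := s) (m := m) hF0
        (by rw [key]; omega) (by rw [key]; omega)
      have h1 : (F (π m s) - F s) ^ 2 ≤ (2 * (1 / 2) ^ m) ^ 2 := by
        rw [← sq_abs]; gcongr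
      have h2 : ((2 : ℝ) * (1 / 2) ^ m) ^ 2 = 4 * (1 / 4) ^ m := by
        rw [mul_pow, ← pow_mul, mul_comm m, pow_mul]; norm_num
      rw [h2] at h1
      nlinarith
    filter_upwards [hconv, hG] with ω h1 h2
    refine tendsto_nhds_unique (hY s ω) ?_
    have hU : ∀ m, U m s ω = Z (π m s) ω := fun m => Set.indicator_of_mem h2 _
    simp only [hU]
    have h3 := ENNReal.tendsto_atTop_zero_of_tsum_ne_top h1.ne
    have h4 : Tendsto (fun m => ‖Z (π m s) ω - Z s ω‖ₑ) atTop (𝓝 0) := by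
      have := (ENNReal.continuous_rpow_const (y := 1 / 4)).tendsto 0 |>.comp h3
      rw [ENNReal.zero_rpow_of_pos (by norm_num)] at this
      refine this.congr fun m => ?_
      simp only [Function.comp]
      rw [← ENNReal.rpow_natCast, ← ENNReal.rpow_mul]
      norm_num
    exact tendsto_iff_edist_tendsto_0.2 (h4.congr fun m => (edist_eq_enorm_sub _ _).symm)
  · obtain ⟨M, hM0, hM1, hM2⟩ := hbound ω
    have hd : ∀ m s, dist (U m s ω) (Y s ω) ≤ M * (9 / 10) ^ m / (1 - 9 / 10) := fun m s =>
      dist_le_of_le_geometric_of_tendsto (9 / 10) M (by norm_num) (fun m => hM1 m s) (hY s ω) m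
    -- The constant is $10+1+10$: two geometric tails from level `m` to the limit, and one step
    -- between neighbouring classes.
    have ht : Tendsto (fun m : ℕ => 21 * M * ((9 : ℝ) / 10) ^ m) atTop (𝓝 (21 * M * 0)) :=
      (tendsto_pow_atTop_nhds_zero_of_lt_one (by norm_num) (by norm_num)).const_mul _
    rw [mul_zero] at ht
    obtain ⟨m, hm⟩ := (ht.eventually (gt_mem_nhds hε)).exists
    refine ⟨(1 / 2) ^ m, by positivity, fun s t hst => ?_⟩
    have h1 := hM2 m s t (dyadicClass_le_of_abs_sub_lt hF0 (by rwa [abs_sub_comm]))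
      (dyadicClass_le_of_abs_sub_lt hF0 hst)
    have h2 := hd m s
    have h3 := hd m t
    have h4 := dist_triangle4 (Y s ω) (U m s ω) (U m t ω) (Y t ω)
    rw [dist_comm (Y s ω) (U m s ω)] at h4
    have h5 : M * (9 / 10) ^ m / (1 - 9 / 10) = 10 * (M * (9 / 10 : ℝ) ^ m) := by ring
    rw [h5] at h2 h3
    linarith

end Chaining

/-! ### Gaussian moments -/

/-- The fourth moment of the standard Gaussian law. -/
noncomputable def gaussianFourthMoment : ℝ := ∫ x, x ^ 4 ∂(gaussianReal 0 1)

theorem integrable_pow_four_gaussianReal (v : ℝ≥0) :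
    Integrable (fun x : ℝ => x ^ 4) (gaussianReal 0 v) := by
  have h := (memLp_id_gaussianReal (μ := 0) (v := v) 4).integrable_norm_pow (p := 4) (by norm_num)
  refine h.congr (ae_of_all _ fun x => ?_)
  simp only [id, Real.norm_eq_abs]
  exact Even.pow_abs (by decide) x

theorem gaussianFourthMoment_nonneg : 0 ≤ gaussianFourthMoment :=
  integral_nonneg fun x => by positivity

/-- By scaling from variance one. The numerical value of the standard fourth moment plays no role.
-/
theorem integral_pow_four_gaussianReal (v : ℝ≥0) :
    ∫ x, x ^ 4 ∂(gaussianReal 0 v) = gaussianFourthMoment * (v : ℝ) ^ 2 := by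
  have h := gaussianReal_map_const_mul (μ := 0) (v := 1) (NNReal.sqrt v : ℝ)
  have hv : (NNReal.mk (((NNReal.sqrt v : ℝ≥0) : ℝ) ^ 2) (sq_nonneg _)) * 1 = v := by
    apply NNReal.eq
    push_cast
    simp
  rw [mul_zero, hv] at h
  rw [← h, integral_map (by fun_prop) (by fun_prop), gaussianFourthMoment]
  simp_rw [mul_pow]
  rw [integral_const_mul, mul_comm]
  congr 1
  have : ((NNReal.sqrt v : ℝ≥0) : ℝ) ^ 2 = v := by rw [← NNReal.coe_pow, NNReal.sq_sqrt]
  calc ((NNReal.sqrt v : ℝ≥0) : ℝ) ^ 4 = (((NNReal.sqrt v : ℝ≥0) : ℝ) ^ 2) ^ 2 := by ring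
    _ = _ := by rw [this]

section Moments

variable {Ω : Type*} {mΩ : MeasurableSpace Ω} {P : Measure Ω} {Z : Ω → ℝ} {v : ℝ≥0}

theorem integrable_pow_four_of_hasLaw (hZ : HasLaw Z (gaussianReal 0 v) P) :
    Integrable (fun ω => Z ω ^ 4) P := by
  have h := integrable_pow_four_gaussianReal v
  rw [← hZ.map_eq] at h
  exact h.comp_aemeasurable hZ.aemeasurable

theorem integral_pow_four_of_hasLaw (hZ : HasLaw Z (gaussianReal 0 v) P) :
    ∫ ω, Z ω ^ 4 ∂P = gaussianFourthMoment * (v : ℝ) ^ 2 := by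
  rw [← integral_pow_four_gaussianReal v]
  exact hZ.integral_comp (f := fun x : ℝ => x ^ 4) (by fun_prop)

theorem lintegral_enorm_pow_four_of_hasLaw (hZ : HasLaw Z (gaussianReal 0 v) P) :
    ∫⁻ ω, ‖Z ω‖ₑ ^ 4 ∂P = ENNReal.ofReal (gaussianFourthMoment * (v : ℝ) ^ 2) := by
  rw [← integral_pow_four_of_hasLaw hZ, ofReal_integral_eq_lintegral_ofReal
    (integrable_pow_four_of_hasLaw hZ) (ae_of_all _ fun ω => by positivity)]
  refine lintegral_congr fun ω => ?_
  rw [← ofReal_norm, ← ENNReal.ofReal_pow (norm_nonneg _), Real.norm_eq_abs,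
    Even.pow_abs (by decide)]

theorem memLp_two_sq_of_hasLaw (hZ : HasLaw Z (gaussianReal 0 v) P) :
    MemLp (fun ω => Z ω ^ 2) 2 P := by
  rw [memLp_two_iff_integrable_sq (hZ.aemeasurable.pow_const 2).aestronglyMeasurable]
  refine (integrable_pow_four_of_hasLaw hZ).congr (ae_of_all _ fun ω => ?_)
  ring

theorem memLp_two_of_hasLaw (hZ : HasLaw Z (gaussianReal 0 v) P) : MemLp Z 2 P :=
  hZ.hasGaussianLaw.memLp_two

theorem integral_of_hasLaw (hZ : HasLaw Z (gaussianReal 0 v) P) : ∫ ω, Z ω ∂P = 0 := by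
  rw [hZ.integral_eq, integral_id_gaussianReal]

theorem integral_sq_of_hasLaw (hZ : HasLaw Z (gaussianReal 0 v) P) : ∫ ω, Z ω ^ 2 ∂P = v := by
  have h := variance_of_integral_eq_zero hZ.aemeasurable (integral_of_hasLaw hZ)
  rw [hZ.variance_eq, variance_id_gaussianReal] at h
  exact h.symm

theorem variance_sq_le_of_hasLaw [IsProbabilityMeasure P] (hZ : HasLaw Z (gaussianReal 0 v) P) :
    Var[fun ω => Z ω ^ 2; P] ≤ gaussianFourthMoment * (v : ℝ) ^ 2 := by
  refine (variance_le_expectation_sq (hZ.aemeasurable.pow_const 2).aestronglyMeasurable).trans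
    (le_of_eq ?_)
  rw [← integral_pow_four_of_hasLaw hZ]
  refine integral_congr_ae (ae_of_all _ fun ω => ?_)
  simp only [Pi.pow_apply]
  ring

end Moments

/-! ### Brownian motion: quadratic variation and semimartingale property -/

section Brownian

variable {Ω : Type*} {mΩ : MeasurableSpace Ω} {P : Measure Ω} [IsProbabilityMeasure P] {T : ℝ≥0}
  {ℱ : Filtration (Time T) mΩ} {c : ℝ≥0} {B : Time T → Ω → ℝ}

theorem IsBrownianMotion.indepFun_increments {P : Measure Ω} (hB : IsBrownianMotion P ℱ c B) {r s t u : Time T}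
    (hrs : r ≤ s) (hst : s ≤ t) (htu : t ≤ u) :
    IndepFun (fun ω => (B s ω - B r ω) ^ 2) (fun ω => (B u ω - B t ω) ^ 2) P := by
  have h : IndepFun (fun ω => B s ω - B r ω) (fun ω => B u ω - B t ω) P := by
    rw [IndepFun_iff_Indep]
    refine (indep_of_indep_of_le_right (hB.indep_increment t u htu) ?_).symm
    have h1 : Measurable[ℱ t] (B s) := ((hB.adapted s).mono (ℱ.mono hst)).measurable
    have h2 : Measurable[ℱ t] (B r) := ((hB.adapted r).mono (ℱ.mono (hrs.trans hst))).measurable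
    exact (h1.sub h2).comap_le
  exact h.comp (φ := fun x : ℝ => x ^ 2) (ψ := fun x : ℝ => x ^ 2) (by fun_prop) (by fun_prop)

theorem IsBrownianMotion.pairwise_indepFun {P : Measure Ω} (hB : IsBrownianMotion P ℱ c B) {π : ℕ → Time T}
    (hπ : Monotone π) (s : Set ℕ) :
    s.Pairwise fun i j => IndepFun (fun ω => (B (π (i + 1)) ω - B (π i) ω) ^ 2)
      (fun ω => (B (π (j + 1)) ω - B (π j) ω) ^ 2) P := by
  intro i _ j _ hij
  rcases lt_or_gt_of_ne hij with h | h
  · exact hB.indepFun_increments (hπ (by omega)) (hπ (by omega)) (hπ (by omega))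
  · exact (hB.indepFun_increments (hπ (by omega)) (hπ (by omega)) (hπ (by omega))).symm

theorem coe_sub_of_le {s t : Time T} (h : s ≤ t) :
    (((c * ((t : ℝ≥0) - (s : ℝ≥0)) : ℝ≥0)) : ℝ)
      = (c : ℝ) * (((t : ℝ≥0) : ℝ) - ((s : ℝ≥0) : ℝ)) := by
  rw [NNReal.coe_mul, NNReal.coe_sub (by exact_mod_cast h)]

theorem IsBrownianMotion.integral_sum_sq {P : Measure Ω} (hB : IsBrownianMotion P ℱ c B) {π : ℕ → Time T}
    (hπ : Monotone π) (h0 : π 0 = ⊥) (N : ℕ) :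
    ∫ ω, ∑ i ∈ Finset.range N, (B (π (i + 1)) ω - B (π i) ω) ^ 2 ∂P
      = (c : ℝ) * (((π N : Time T) : ℝ≥0) : ℝ) := by
  rw [integral_finsetSum _ fun i _ =>
    (memLp_two_of_hasLaw (hB.law_increment _ _ (hπ (Nat.le_succ i)))).integrable_sq]
  have : ∀ i ∈ Finset.range N, ∫ ω, (B (π (i + 1)) ω - B (π i) ω) ^ 2 ∂P
      = (fun i => (c : ℝ) * (((π i : Time T) : ℝ≥0) : ℝ)) (i + 1)
        - (fun i => (c : ℝ) * (((π i : Time T) : ℝ≥0) : ℝ)) i := by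
    intro i _
    rw [integral_sq_of_hasLaw (hB.law_increment _ _ (hπ (Nat.le_succ i))),
      coe_sub_of_le (hπ (Nat.le_succ i)), mul_sub]
  rw [Finset.sum_congr rfl this,
    Finset.sum_range_sub (fun i => (c : ℝ) * (((π i : Time T) : ℝ≥0) : ℝ)), h0]
  have : (((⊥ : Time T) : ℝ≥0) : ℝ) = 0 := by
    have : ((⊥ : Time T) : ℝ≥0) = 0 := rfl
    rw [this, NNReal.coe_zero]
  simp only [this, mul_zero, sub_zero]

/-- Independence makes the variances additive. Each is at most a constant times
$(\Delta_i)^2\le\delta\,\Delta_i$, and the $\Delta_i$ telescope. -/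
theorem IsBrownianMotion.variance_sum_sq_le (hB : IsBrownianMotion P ℱ c B) {π : ℕ → Time T}
    (hπ : Monotone π) (h0 : π 0 = ⊥) {N : ℕ} {δ : ℝ}
    (hδ : ∀ i < N, dist (π (i + 1)) (π i) ≤ δ) :
    Var[fun ω => ∑ i ∈ Finset.range N, (B (π (i + 1)) ω - B (π i) ω) ^ 2; P]
      ≤ gaussianFourthMoment * (c : ℝ) ^ 2 * (((π N : Time T) : ℝ≥0) : ℝ) * δ := by
  have hlaw := fun i => hB.law_increment _ _ (hπ (Nat.le_succ i))
  have hv := IndepFun.variance_sum (μ := P) (s := Finset.range N)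
    (X := fun i ω => (B (π (i + 1)) ω - B (π i) ω) ^ 2)
    (fun i _ => memLp_two_sq_of_hasLaw (hlaw i)) (hB.pairwise_indepFun hπ _)
  have hfun : (fun ω => ∑ i ∈ Finset.range N, (B (π (i + 1)) ω - B (π i) ω) ^ 2)
      = ∑ i ∈ Finset.range N, fun ω => (B (π (i + 1)) ω - B (π i) ω) ^ 2 := by
    ext ω; simp
  rw [hfun, hv]
  let τ : ℕ → ℝ := fun i => (((π i : Time T) : ℝ≥0) : ℝ)
  have hτ : ∀ i, τ i ≤ τ (i + 1) := fun i => by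
    have : π i ≤ π (i + 1) := hπ (Nat.le_succ i)
    exact_mod_cast this
  have hterm : ∀ i ∈ Finset.range N, Var[fun ω => (B (π (i + 1)) ω - B (π i) ω) ^ 2; P]
      ≤ gaussianFourthMoment * (c : ℝ) ^ 2 * δ * (τ (i + 1) - τ i) := by
    intro i hi
    refine (variance_sq_le_of_hasLaw (hlaw i)).trans ?_
    rw [coe_sub_of_le (hπ (Nat.le_succ i))]
    have h1 : τ (i + 1) - τ i ≤ δ := by
      have := hδ i (Finset.mem_range.1 hi)
      have e : dist (π (i + 1)) (π i) = |τ (i + 1) - τ i| := rfl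
      rw [e] at this
      exact (le_abs_self _).trans this
    have h2 := sub_nonneg.2 (hτ i)
    have h3 := gaussianFourthMoment_nonneg
    calc gaussianFourthMoment * ((c : ℝ) * (τ (i + 1) - τ i)) ^ 2
        = gaussianFourthMoment * (c : ℝ) ^ 2 * (τ (i + 1) - τ i) * (τ (i + 1) - τ i) := by ring
      _ ≤ gaussianFourthMoment * (c : ℝ) ^ 2 * δ * (τ (i + 1) - τ i) := by gcongr
  refine (Finset.sum_le_sum hterm).trans (le_of_eq ?_)
  rw [← Finset.mul_sum, Finset.sum_range_sub]
  have : τ 0 = 0 := by simp only [τ, h0]; rfl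
  rw [this]
  simp only [τ]
  ring

theorem IsBrownianMotion.hasQuadraticVariation (hB : IsBrownianMotion P ℱ c B) :
    HasQuadraticVariation P B fun t _ => (c : ℝ) * ((t : ℝ≥0) : ℝ) := by
  intro t N π hmono h0 hN hmesh
  rw [tendstoInMeasure_iff_norm]
  intro ε hε
  rw [ENNReal.tendsto_nhds_zero]
  intro η hη
  obtain ⟨r, hr0, hr⟩ : ∃ r : ℝ, 0 < r ∧ ENNReal.ofReal r ≤ η := by
    rcases eq_or_ne η ∞ with h | h
    · exact ⟨1, one_pos, by simp [h]⟩
    · exact ⟨η.toReal, ENNReal.toReal_pos hη.ne' h, ENNReal.ofReal_toReal_le⟩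
  set K : ℝ := gaussianFourthMoment * (c : ℝ) ^ 2 * ((t : ℝ≥0) : ℝ) with hK
  have hK0 : 0 ≤ K := by have := gaussianFourthMoment_nonneg; positivity
  -- This mesh makes the variance at most $r\varepsilon^2$, as Chebyshev's inequality requires; `K +
  -- 1` replaces `K` because `K` may vanish.
  have hδ : 0 < r * ε ^ 2 / (K + 1) := by positivity
  filter_upwards [hmesh _ hδ] with k hk
  have hint := hB.integral_sum_sq (hmono k) (h0 k) (N k)
  have hvar := hB.variance_sum_sq_le (hmono k) (h0 k) hk
  rw [hN k] at hint hvar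
  have hL : MemLp (fun ω => ∑ i ∈ Finset.range (N k), (B (π k (i + 1)) ω - B (π k i) ω) ^ 2) 2 P :=
    memLp_finsetSum _ fun i _ =>
      memLp_two_sq_of_hasLaw (hB.law_increment _ _ (hmono k (Nat.le_succ i)))
  have hch := meas_ge_le_variance_div_sq hL hε
  rw [hint] at hch
  refine (hch.trans (ENNReal.ofReal_le_ofReal ?_)).trans hr
  rw [div_le_iff₀ (by positivity)]
  refine hvar.trans ?_
  rw [← hK]
  have : K / (K + 1) ≤ 1 := by rw [div_le_one (by positivity)]; linarith
  calc K * (r * ε ^ 2 / (K + 1)) = (K / (K + 1)) * (r * ε ^ 2) := by ring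
    _ ≤ 1 * (r * ε ^ 2) := by gcongr
    _ = r * ε ^ 2 := one_mul _

theorem IsBrownianMotion.martingale (hB : IsBrownianMotion P ℱ c B) : Martingale B ℱ P := by
  have hint0 : ∀ s t, s ≤ t → Integrable (fun ω => B t ω - B s ω) P := fun s t h =>
    (memLp_two_of_hasLaw (hB.law_increment s t h)).integrable (by norm_num)
  have hint : ∀ t, Integrable (B t) P := fun t => by
    refine (hint0 ⊥ t bot_le).congr ?_
    filter_upwards [hB.start_zero] with ω hω
    rw [hω, sub_zero]
  refine ⟨hB.adapted, fun s t hst => ?_⟩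
  have hm : StronglyMeasurable (fun ω => B t ω - B s ω) :=
    ((hB.adapted t).mono (ℱ.le t)).sub ((hB.adapted s).mono (ℱ.le s))
  have h1 : P[fun ω => B t ω - B s ω | ℱ s] =ᵐ[P] fun _ => ∫ ω, B t ω - B s ω ∂P :=
    condExp_indep_eq hm.measurable.comap_le (ℱ.le s)
      (comap_measurable _).stronglyMeasurable (hB.indep_increment s t hst)
  have h2 : P[B s | ℱ s] = B s := condExp_of_stronglyMeasurable (ℱ.le s) (hB.adapted s) (hint s)
  have h3 : P[B t | ℱ s] =ᵐ[P] P[fun ω => B t ω - B s ω | ℱ s] + P[B s | ℱ s] := by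
    refine EventuallyEq.trans ?_ (condExp_add (hint0 s t hst) (hint s) _)
    refine (condExp_congr_ae (ae_of_all _ fun ω => ?_))
    simp
  filter_upwards [h1, h3] with ω e1 e3
  rw [e3, Pi.add_apply, e1, integral_of_hasLaw (hB.law_increment s t hst), h2, zero_add]

theorem isCadlag_of_continuous {f : Time T → ℝ} (hf : Continuous f) : IsCadlag f := fun t =>
  ⟨hf.continuousWithinAt, f t, hf.continuousWithinAt⟩

theorem IsBrownianMotion.isSemimartingale (hB : IsBrownianMotion P ℱ c B) :
    IsSemimartingale P ℱ B := by
  refine ⟨hB.adapted, B, fun _ _ => 0, ?_, fun _ => stronglyMeasurable_const, ?_, ?_⟩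
  · refine Locally.of_prop ⟨hB.martingale, ?_⟩
    filter_upwards [hB.continuous_paths] with ω hω
    exact isCadlag_of_continuous hω
  · refine ae_of_all _ fun ω => ⟨isCadlag_of_continuous continuous_const, ?_⟩
    rw [BoundedVariationOn, eVariationOn.constant_on]
    · exact ENNReal.zero_ne_top
    · rintro _ ⟨_, _, rfl⟩ _ ⟨_, _, rfl⟩
      rfl
  · exact ae_of_all _ fun ω t => by simp

end Brownian

/-! ### The cylindrical Wiener process of a white noise -/

/-- A map that multiplies inner products by a constant is linear and bounded. -/
theorem exists_continuousLinearMap_of_inner {E F : Type*} [NormedAddCommGroup E]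
    [InnerProductSpace ℝ E] [NormedAddCommGroup F] [InnerProductSpace ℝ F] {f : E → F} {c : ℝ}
    (h : ∀ a b, inner ℝ (f a) (f b) = c * inner ℝ a b) : ∃ L : E →L[ℝ] F, ∀ a, L a = f a := by
  -- Linearity is forced by the inner products: the squared norm of the defect expands into terms
  -- that cancel. Hence it need not be part of the definition of white noise.
  have hadd : ∀ a b, f (a + b) = f a + f b := fun a b => by
    rw [← sub_eq_zero, ← inner_self_eq_zero (𝕜 := ℝ)]
    simp only [inner_sub_left, inner_sub_right, inner_add_left, inner_add_right, h]
    ring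
  have hsmul : ∀ (r : ℝ) a, f (r • a) = r • f a := fun r a => by
    rw [← sub_eq_zero, ← inner_self_eq_zero (𝕜 := ℝ)]
    simp only [inner_sub_left, inner_sub_right, inner_smul_left, inner_smul_right, h,
      RCLike.conj_to_real]
    ring
  let L : E →ₗ[ℝ] F := { toFun := f, map_add' := hadd, map_smul' := hsmul }
  refine ⟨L.mkContinuous (Real.sqrt |c|) fun x => ?_, fun a => rfl⟩
  have h1 : ‖f x‖ ^ 2 = c * ‖x‖ ^ 2 := by
    rw [← real_inner_self_eq_norm_sq, ← real_inner_self_eq_norm_sq, h]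
  refine le_of_sq_le_sq ?_ (by positivity)
  change ‖f x‖ ^ 2 ≤ _
  rw [h1, mul_pow, Real.sq_sqrt (abs_nonneg c)]
  gcongr
  exact le_abs_self c

section WhiteNoise

variable {T : ℝ≥0} {d : ℕ}

theorem inner_eq_integral_mul {α : Type*} [MeasurableSpace α] {μ : Measure α} (f g : Lp ℝ 2 μ) :
    inner ℝ f g = ∫ x, f x * g x ∂μ := by
  rw [L2.inner_def]
  refine integral_congr_ae (ae_of_all _ fun x => ?_)
  simp only [RCLike.inner_apply, RCLike.conj_to_real]
  ring

theorem inner_indicatorTensor (s t : Time T) (φ ψ : SpaceL2 d) :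
    ∫ p, indicatorTensor s φ p * indicatorTensor t ψ p ∂(spaceTimeMeasure T d)
      = ((min s t : Time T) : ℝ≥0) * inner ℝ φ ψ := by
  have e1 := (memLp_indicatorTensor s φ).coeFn_toLp
  have e2 := (memLp_indicatorTensor t ψ).coeFn_toLp
  have h : ∫ p, indicatorTensor s φ p * indicatorTensor t ψ p ∂(spaceTimeMeasure T d)
      = ∫ p : ℝ × Space d, (Set.Icc 0 (((min s t : Time T) : ℝ≥0) : ℝ)).indicator 1 p.1
          * (φ p.2 * ψ p.2) ∂(spaceTimeMeasure T d) := by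
    refine integral_congr_ae ?_
    filter_upwards [e1, e2] with p h1 h2
    rw [indicatorTensor, indicatorTensor, h1, h2]
    have hmin : (((min s t : Time T) : ℝ≥0) : ℝ) = min ((s : ℝ≥0) : ℝ) ((t : ℝ≥0) : ℝ) := by
      rcases le_total s t with hst | hst
      · rw [min_eq_left hst, min_eq_left (by exact_mod_cast hst)]
      · rw [min_eq_right hst, min_eq_right (by exact_mod_cast hst)]
    simp only [Set.indicator_apply, Set.mem_prod, Set.mem_Icc, Set.mem_univ, and_true, hmin,
      le_min_iff, Pi.one_apply]
    by_cases a : 0 ≤ p.1 <;> by_cases b : p.1 ≤ ((s : ℝ≥0) : ℝ) <;>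
      by_cases c : p.1 ≤ ((t : ℝ≥0) : ℝ) <;> simp [a, b, c]
  rw [h, spaceTimeMeasure, integral_prod_mul (L := ℝ)
    (fun r : ℝ => (Set.Icc 0 (((min s t : Time T) : ℝ≥0) : ℝ)).indicator 1 r)
    (fun x => φ x * ψ x), inner_eq_integral_mul]
  congr 1
  rw [integral_indicator_one measurableSet_Icc, measureReal_restrict_apply measurableSet_Icc,
    Set.inter_eq_left.2]
  · simp
  · refine Set.Icc_subset_Icc_right ?_
    exact_mod_cast (min s t).2

variable {Ω : Type*} {mΩ : MeasurableSpace Ω} {P : Measure Ω} {Wdot : SpaceTimeL2 T d → Lp ℝ 2 P}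

theorem IsSpaceTimeWhiteNoise.inner_cylindricalWiener (hW : IsSpaceTimeWhiteNoise P Wdot)
    (s t : Time T) (φ ψ : SpaceL2 d) :
    inner ℝ (cylindricalWiener Wdot s φ) (cylindricalWiener Wdot t ψ)
      = ((min s t : Time T) : ℝ≥0) * inner ℝ φ ψ := by
  rw [inner_eq_integral_mul, cylindricalWiener, cylindricalWiener, hW.covariance,
    inner_indicatorTensor]

/-- For fixed `t`, the cylindrical Wiener process is a bounded linear operator. -/
noncomputable def IsSpaceTimeWhiteNoise.wienerCLM (hW : IsSpaceTimeWhiteNoise P Wdot)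
    (t : Time T) : SpaceL2 d →L[ℝ] Lp ℝ 2 P :=
  (exists_continuousLinearMap_of_inner (hW.inner_cylindricalWiener t t)).choose

theorem IsSpaceTimeWhiteNoise.wienerCLM_apply (hW : IsSpaceTimeWhiteNoise P Wdot)
    (t : Time T) (φ : SpaceL2 d) : hW.wienerCLM t φ = cylindricalWiener Wdot t φ :=
  (exists_continuousLinearMap_of_inner (hW.inner_cylindricalWiener t t)).choose_spec φ

/-- Increments of the cylindrical Wiener process are Gaussian. -/
theorem IsSpaceTimeWhiteNoise.hasLaw_increment [IsProbabilityMeasure P]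
    (hW : IsSpaceTimeWhiteNoise P Wdot) {s t : Time T} (hst : s ≤ t) (φ : SpaceL2 d) :
    HasLaw (fun ω => cylindricalWiener Wdot t φ ω - cylindricalWiener Wdot s φ ω)
      (gaussianReal 0 (‖φ‖₊ ^ 2 * ((t : ℝ≥0) - (s : ℝ≥0)))) P := by
  set U := cylindricalWiener Wdot t φ with hU
  set V := cylindricalWiener Wdot s φ with hV
  have hg : HasGaussianLaw (fun ω => U ω - V ω) P :=
    hW.gaussian.hasGaussianLaw_fun_sub
  refine ⟨hg.aemeasurable, ?_⟩
  have hm : ∫ ω, U ω - V ω ∂P = 0 := by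
    rw [integral_sub ((Lp.memLp U).integrable (by norm_num))
      ((Lp.memLp V).integrable (by norm_num)), hU, hV, cylindricalWiener, cylindricalWiener,
      hW.mean_zero, hW.mean_zero, sub_zero]
  rw [hg.map_eq_gaussianReal, hm]
  congr 1
  rw [variance_of_integral_eq_zero hg.aemeasurable hm]
  have h1 : ∫ ω, (U ω - V ω) ^ 2 ∂P = inner ℝ (U - V) (U - V) := by
    rw [inner_eq_integral_mul]
    refine integral_congr_ae ?_
    filter_upwards [Lp.coeFn_sub U V] with ω hω
    rw [hω, Pi.sub_apply]
    ring
  rw [h1]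
  apply NNReal.eq
  have h2 : inner ℝ (U - V) (U - V) = ‖φ‖ ^ 2 * (((t : ℝ≥0) : ℝ) - ((s : ℝ≥0) : ℝ)) := by
    simp only [inner_sub_left, inner_sub_right, hU, hV, hW.inner_cylindricalWiener, min_self,
      min_eq_left hst, min_eq_right hst, real_inner_self_eq_norm_sq]
    ring
  have h3 : ((s : ℝ≥0) : ℝ) ≤ ((t : ℝ≥0) : ℝ) := by exact_mod_cast hst
  rw [h2, Real.coe_toNNReal _ (mul_nonneg (sq_nonneg _) (sub_nonneg.2 h3)), NNReal.coe_mul,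
    NNReal.coe_sub (by exact_mod_cast hst)]
  simp

theorem IsSpaceTimeWhiteNoise.cylindricalWiener_bot (hW : IsSpaceTimeWhiteNoise P Wdot)
    (φ : SpaceL2 d) : cylindricalWiener Wdot ⊥ φ = 0 := by
  rw [← inner_self_eq_zero (𝕜 := ℝ), hW.inner_cylindricalWiener, min_self]
  have : ((⊥ : Time T) : ℝ≥0) = 0 := rfl
  simp [this]

/-- The natural filtration of the cylindrical Wiener process, augmented by null sets. -/
noncomputable def wienerFiltration (P : Measure Ω) (Wdot : SpaceTimeL2 T d → Lp ℝ 2 P) :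
    Filtration (Time T) mΩ where
  -- The augmentation makes every measurable version of $W_t(\varphi)$ adapted. The intersection
  -- with `mΩ` is needed because sets almost everywhere equal to measurable ones need not lie in
  -- `mΩ`.
  seq t := mΩ ⊓ eventuallyMeasurableSpace
    (MeasurableSpace.comap (fun ω (p : Set.Iic t × SpaceL2 d) =>
      cylindricalWiener Wdot p.1 p.2 ω) inferInstance) (ae P)
  mono' := by
    intro s t hst
    refine inf_le_inf_left _ ?_
    rintro A ⟨B, hB, hAB⟩
    refine ⟨B, ?_, hAB⟩
    obtain ⟨C, hC, rfl⟩ := hB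
    let r : (Set.Iic t × SpaceL2 d → ℝ) → (Set.Iic s × SpaceL2 d → ℝ) :=
      fun f p => f (⟨p.1, p.1.2.trans hst⟩, p.2)
    have hr : Measurable r := measurable_pi_lambda _ fun p => measurable_pi_apply _
    exact ⟨r ⁻¹' C, hr hC, rfl⟩
  le' t := inf_le_left

theorem stronglyMeasurable_wienerFiltration {t : Time T} {φ : SpaceL2 d} {X : Ω → ℝ}
    (hX : StronglyMeasurable X) (h : X =ᵐ[P] cylindricalWiener Wdot t φ) :
    StronglyMeasurable[wienerFiltration P Wdot t] X := by
  refine Measurable.stronglyMeasurable ?_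
  refine fun A hA => MeasurableSpace.measurableSet_inf.2 ⟨hX.measurable hA, ?_⟩
  refine ⟨cylindricalWiener Wdot t φ ⁻¹' A, ?_, ?_⟩
  · let q : Set.Iic t × SpaceL2 d := (⟨t, le_refl t⟩, φ)
    have : Measurable fun f : Set.Iic t × SpaceL2 d → ℝ => f q := measurable_pi_apply q
    exact ⟨_, this hA, rfl⟩
  · exact h.preimage A

/-- Increments are independent of the past. -/
theorem IsSpaceTimeWhiteNoise.indep_increment
    (hW : IsSpaceTimeWhiteNoise P Wdot) {s t : Time T} (hst : s ≤ t) (φ : SpaceL2 d) {Z : Ω → ℝ}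
    (hZ : Z =ᵐ[P] fun ω => cylindricalWiener Wdot t φ ω - cylindricalWiener Wdot s φ ω) :
    Indep (MeasurableSpace.comap Z inferInstance) (wienerFiltration P Wdot s) P := by
  have := hW.gaussian.isProbabilityMeasure
  let V : Unit → Ω → ℝ := fun _ ω =>
    cylindricalWiener Wdot t φ ω - cylindricalWiener Wdot s φ ω
  let U : Set.Iic s × SpaceL2 d → Ω → ℝ := fun p ω => cylindricalWiener Wdot p.1 p.2 ω
  have hg : IsGaussianProcess (Sum.elim V U) P := by
    classical
    refine hW.gaussian.of_isGaussianProcess fun q => ?_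
    rcases q with q | q
    · refine ⟨{indicatorTensor t φ, indicatorTensor s φ},
        ContinuousLinearMap.proj ⟨indicatorTensor t φ, by simp⟩
          - ContinuousLinearMap.proj ⟨indicatorTensor s φ, by simp⟩, fun ω => ?_⟩
      simp [V, cylindricalWiener]
    · refine ⟨{indicatorTensor q.1 q.2},
        ContinuousLinearMap.proj ⟨indicatorTensor q.1 q.2, by simp⟩, fun ω => ?_⟩
      simp [U, cylindricalWiener]
  -- For jointly Gaussian families zero covariance suffices. Against $W_r(\psi)$ with $r\le s$ it is
  -- $(\min(t,r)-\min(s,r))\langle\varphi,\psi\rangle=0$.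
  have hind : IndepFun (fun ω u => V u ω) (fun ω p => U p ω) P := by
    refine hg.indepFun_of_covariance_eq_zero
      (fun u => ((Lp.stronglyMeasurable _).sub (Lp.stronglyMeasurable _)).aemeasurable)
      (fun p => (Lp.stronglyMeasurable _).aemeasurable) fun u p => ?_
    have hL : ∀ f : Lp ℝ 2 P, MemLp f 2 P := fun f => Lp.memLp f
    have hcov : ∀ r, cov[(cylindricalWiener Wdot r φ : Ω → ℝ), U p; P]
        = ((min r p.1.1 : Time T) : ℝ≥0) * inner ℝ φ p.2 := fun r => by
      rw [covariance_eq_sub (hL _) (hL _), ← hW.inner_cylindricalWiener, inner_eq_integral_mul,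
        cylindricalWiener, hW.mean_zero, zero_mul, sub_zero]
      rfl
    have hp : p.1.1 ≤ s := p.1.2
    change cov[(cylindricalWiener Wdot t φ : Ω → ℝ) - (cylindricalWiener Wdot s φ : Ω → ℝ),
      U p; P] = 0
    rw [covariance_sub_left (hL _) (hL _) (hL _), hcov, hcov, min_eq_right hp,
      min_eq_right (hp.trans hst), sub_self]
  rw [Indep_iff]
  rintro A B ⟨A', hA', rfl⟩ hB
  obtain ⟨-, C, ⟨C', hC', rfl⟩, hBC⟩ := MeasurableSpace.measurableSet_inf.1 hB
  have hA : Z ⁻¹' A' =ᵐ[P] (fun ω u => V u ω) ⁻¹' ((fun f : Unit → ℝ => f ()) ⁻¹' A') :=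
    hZ.preimage A'
  rw [measure_congr (hA.inter hBC), measure_congr hA, measure_congr hBC]
  exact (indepFun_iff_measure_inter_preimage_eq_mul.1 hind) _ _
    ((measurable_pi_apply ()) hA') hC'

theorem IsSpaceTimeWhiteNoise.isBrownianMotion [IsProbabilityMeasure P]
    (hW : IsSpaceTimeWhiteNoise P Wdot) {φ : SpaceL2 d} {X : Time T → Ω → ℝ}
    (hXm : ∀ t, StronglyMeasurable (X t)) (hX : ∀ t, X t =ᵐ[P] cylindricalWiener Wdot t φ)
    (hc : ∀ ω, Continuous fun t => X t ω) :
    IsBrownianMotion P (wienerFiltration P Wdot) (‖φ‖₊ ^ 2) X where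
  adapted t := stronglyMeasurable_wienerFiltration (hXm t) (hX t)
  start_zero := by
    have h := hX ⊥
    rw [hW.cylindricalWiener_bot] at h
    filter_upwards [h, Lp.coeFn_zero ℝ 2 P] with ω h1 h2
    rw [h1, h2, Pi.zero_apply]
  continuous_paths := ae_of_all _ hc
  law_increment s t hst := (hW.hasLaw_increment hst φ).congr ((hX t).sub (hX s))
  indep_increment s t hst := hW.indep_increment hst φ ((hX t).sub (hX s))

end WhiteNoise

/-! ### An integral representation of smooth functions -/

section DirOp

variable {V V' : Type*} [NormedAddCommGroup V] [NormedSpace ℝ V]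
  [NormedAddCommGroup V'] [NormedSpace ℝ V']

/-- The differential operator `1 + ∂_v`. -/
noncomputable def dirOp (v : V) (f : V → ℝ) (x : V) : ℝ := f x + fderiv ℝ f x v

/-- The product of the operators `1 + ∂_v` over a list of directions. -/
noncomputable def dirOps (l : List V) (f : V → ℝ) : V → ℝ := l.foldr dirOp f

theorem contDiff_dirOps {f : V → ℝ} (hf : ContDiff ℝ (⊤ : ℕ∞) f) (l : List V) :
    ContDiff ℝ (⊤ : ℕ∞) (dirOps l f) := by
  induction l with
  | nil => exact hf
  | cons v l ih =>
    have h : ContDiff ℝ (⊤ : ℕ∞) (fderiv ℝ (dirOps l f)) :=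
      ih.fderiv_right (m := (⊤ : ℕ∞)) (by simp)
    exact ih.add (h.clm_apply contDiff_const)

theorem hasCompactSupport_dirOps {f : V → ℝ} (hf : HasCompactSupport f) (l : List V) :
    HasCompactSupport (dirOps l f) := by
  induction l with
  | nil => exact hf
  | cons v l ih => exact ih.add (ih.fderiv_apply (𝕜 := ℝ) v)

/-- The chain rule. It restricts the operators to lines and hyperplanes, and transfers them between
`Fin d → ℝ` and `Space d`. -/
theorem dirOps_comp_affine {f : V' → ℝ} (hf : ContDiff ℝ (⊤ : ℕ∞) f) (L : V →L[ℝ] V') (a : V')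
    (l : List V) :
    dirOps l (fun u => f (a + L u)) = fun u => dirOps (l.map L) f (a + L u) := by
  induction l with
  | nil => rfl
  | cons v l ih =>
    ext u
    change dirOp v (dirOps l fun u => f (a + L u)) u = dirOp (L v) (dirOps (l.map L) f) (a + L u)
    rw [ih, dirOp, dirOp]
    have h1 : DifferentiableAt ℝ (dirOps (l.map L) f) (a + L u) :=
      (contDiff_dirOps hf _).differentiable (by simp) _
    have h2 : HasFDerivAt (fun u => a + L u) L u := L.hasFDerivAt.const_add a
    have h3 := h1.hasFDerivAt.comp u h2
    have h4 : fderiv ℝ (fun u => dirOps (l.map L) f (a + L u)) u = _ := h3.fderiv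
    rw [h4]
    rfl

end DirOp

/-- The density of the exponential law. -/
noncomputable def expHalf (s : ℝ) : ℝ := (Set.Ioi (0 : ℝ)).indicator (fun s => Real.exp (-s)) s

theorem expHalf_nonneg (s : ℝ) : 0 ≤ expHalf s :=
  Set.indicator_nonneg (fun _ _ => (Real.exp_pos _).le) s

theorem expHalf_le_one (s : ℝ) : expHalf s ≤ 1 := by
  refine Set.indicator_le' (fun s hs => ?_) (fun _ _ => zero_le_one) s
  exact Real.exp_le_one_iff.2 (by simpa using hs.le)

theorem measurable_expHalf : Measurable expHalf :=
  (by fun_prop : Measurable fun s : ℝ => Real.exp (-s)).indicator measurableSet_Ioi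

theorem integrable_expHalf : Integrable expHalf := by
  have : IntegrableOn (fun s : ℝ => Real.exp (-s)) (Set.Ioi 0) := integrableOn_exp_neg_Ioi 0
  exact this.integrable_indicator measurableSet_Ioi

/-- The integrand on $(0,\infty)$ is the derivative of $-e^{-s}h(-s)$, so integration against the
exponential density inverts $1+\partial$. -/
theorem integral_expHalf_mul {h : ℝ → ℝ} (hh : ContDiff ℝ (⊤ : ℕ∞) h) (hc : HasCompactSupport h) :
    ∫ s, expHalf s * dirOp 1 h (-s) = h 0 := by
  have hd : ∀ s, HasDerivAt (fun s => -(Real.exp (-s) * h (-s)))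
      (Real.exp (-s) * dirOp 1 h (-s)) s := by
    intro s
    have e1 : HasDerivAt (fun s : ℝ => Real.exp (-s)) (Real.exp (-s) * -1) s :=
      (hasDerivAt_neg s).exp
    have e2 : HasDerivAt h (deriv h (-s)) (-s) :=
      (hh.differentiable (by simp) _).hasDerivAt
    have e3 : HasDerivAt (fun s => h (-s)) (deriv h (-s) * -1) s := e2.comp s (hasDerivAt_neg s)
    have e4 := (e1.mul e3).neg
    refine e4.congr_deriv ?_
    rw [dirOp]
    rw [fderiv_apply_one_eq_deriv]
    ring
  have hk : Continuous fun s => Real.exp (-s) * dirOp 1 h (-s) := by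
    have : Continuous (dirOp 1 h) := (contDiff_dirOps hh [1]).continuous
    fun_prop
  have hkc : HasCompactSupport fun s => Real.exp (-s) * dirOp 1 h (-s) := by
    have : HasCompactSupport (dirOp 1 h) := hasCompactSupport_dirOps hc [1]
    exact (this.comp_homeomorph (Homeomorph.neg ℝ)).mul_left
  have hlim : Tendsto (fun s => -(Real.exp (-s) * h (-s))) atTop (𝓝 0) := by
    have hz : HasCompactSupport fun s => -(Real.exp (-s) * h (-s)) := by
      have : HasCompactSupport fun s => Real.exp (-s) * h (-s) :=
        (hc.comp_homeomorph (Homeomorph.neg ℝ)).mul_left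
      exact this.comp_left (g := fun x : ℝ => -x) neg_zero
    exact hz.is_zero_at_infty.mono_left atTop_le_cocompact
  have key := integral_Ioi_of_hasDerivAt_of_tendsto (a := 0) (hd 0).continuousAt.continuousWithinAt
    (fun s _ => hd s) (hk.integrable_of_hasCompactSupport hkc).integrableOn hlim
  rw [← integral_indicator measurableSet_Ioi] at key
  simp only [neg_zero, Real.exp_zero, one_mul, zero_sub, neg_neg] at key
  rw [← key]
  refine integral_congr_ae (ae_of_all _ fun s => ?_)
  by_cases hs : s ∈ Set.Ioi (0 : ℝ) <;> simp [expHalf, hs]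

theorem measurable_prod_expHalf {d : ℕ} : Measurable fun u : Fin d → ℝ => ∏ i, expHalf (u i) :=
  Finset.measurable_prod _ fun i _ => measurable_expHalf.comp (measurable_pi_apply i)

theorem prod_expHalf_nonneg {d : ℕ} (u : Fin d → ℝ) : 0 ≤ ∏ i, expHalf (u i) :=
  Finset.prod_nonneg fun _ _ => expHalf_nonneg _

theorem prod_expHalf_le_one {d : ℕ} (u : Fin d → ℝ) : ∏ i, expHalf (u i) ≤ 1 :=
  Finset.prod_le_one (fun _ _ => expHalf_nonneg _) fun _ _ => expHalf_le_one _

theorem integrable_prod_expHalf_mul {d : ℕ} {k : (Fin d → ℝ) → ℝ} (hk : Continuous k)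
    (hc : HasCompactSupport k) : Integrable fun u : Fin d → ℝ => (∏ i, expHalf (u i)) * k (-u) := by
  have h1 : Integrable fun u : Fin d → ℝ => k (-u) :=
    (hk.comp continuous_neg).integrable_of_hasCompactSupport (hc.comp_homeomorph (Homeomorph.neg _))
  refine h1.bdd_mul (c := 1) measurable_prod_expHalf.aestronglyMeasurable (ae_of_all _ fun u => ?_)
  rw [Real.norm_eq_abs, abs_of_nonneg (prod_expHalf_nonneg u)]
  exact prod_expHalf_le_one u

/-- Induction on the dimension. By Fubini, the one-variable identity on lines parallel to the first
axis removes the outermost operator; what remains is the same integral for the restriction of `f` to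
the hyperplane where the first coordinate vanishes. -/
theorem integral_prod_expHalf_mul_dirOps {d : ℕ} {f : (Fin d → ℝ) → ℝ}
    (hf : ContDiff ℝ (⊤ : ℕ∞) f) (hc : HasCompactSupport f) :
    ∫ u : Fin d → ℝ, (∏ i, expHalf (u i)) *
      dirOps ((List.finRange d).map fun i => Pi.single i (1 : ℝ)) f (-u) = f 0 := by
  induction d with
  | zero =>
    simp only [Finset.univ_eq_empty, Finset.prod_empty, List.finRange_zero, List.map_nil, one_mul]
    rw [integral_unique, Measure.real, volume_pi, Measure.pi_univ]
    simp [dirOps]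
  | succ d ih =>
    set K : (Fin (d + 1) → ℝ) → ℝ :=
      dirOps ((List.finRange d).map fun i => Pi.single i.succ (1 : ℝ)) f with hK
    have hKs : ContDiff ℝ (⊤ : ℕ∞) K := contDiff_dirOps hf _
    have hKc : HasCompactSupport K := hasCompactSupport_dirOps hc _
    have hlist : dirOps ((List.finRange (d + 1)).map fun i => Pi.single i (1 : ℝ)) f
        = dirOp (Pi.single 0 1) K := by
      rw [List.finRange_succ, List.map_cons, List.map_map]
      rfl
    rw [hlist]
    have hint := integrable_prod_expHalf_mul
      (contDiff_dirOps hKs [Pi.single 0 (1 : ℝ)]).continuous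
      (hasCompactSupport_dirOps hKc [Pi.single 0 (1 : ℝ)])
    change Integrable fun u : Fin (d + 1) → ℝ =>
      (∏ i, expHalf (u i)) * dirOp (Pi.single 0 1) K (-u) at hint
    have mp := (volume_preserving_piFinSuccAbove (fun _ : Fin (d + 1) => ℝ) 0).symm
    rw [← mp.integral_comp (MeasurableEquiv.measurableEmbedding _)]
    have hint' := (mp.integrable_comp_emb (MeasurableEquiv.measurableEmbedding _)).2 hint
    rw [Measure.volume_eq_prod] at hint' ⊢
    refine (integral_prod_symm _ hint').trans ?_
    -- `J` parametrizes that hyperplane and `e0` the first axis.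
    let J : (Fin d → ℝ) →L[ℝ] (Fin (d + 1) → ℝ) :=
      ContinuousLinearMap.pi (Fin.cons 0 fun i => ContinuousLinearMap.proj i)
    have hJ : ∀ w, J w = Fin.cons 0 w := fun w => by
      ext i
      refine Fin.cases ?_ (fun i => ?_) i <;> simp [J]
    let e0 : ℝ →L[ℝ] (Fin (d + 1) → ℝ) := ContinuousLinearMap.toSpanSingleton ℝ (Pi.single 0 1)
    have he0 : ∀ s, e0 s = Fin.cons s 0 := fun s => by
      ext i
      refine Fin.cases ?_ (fun i => ?_) i <;> simp [e0, ContinuousLinearMap.toSpanSingleton_apply]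
    have hcons : ∀ (s : ℝ) (w : Fin d → ℝ), -(Fin.cons s w : Fin (d + 1) → ℝ) = J (-w) + e0 (-s) :=
      fun s w => by
        ext i
        rw [hJ, he0]
        refine Fin.cases ?_ (fun i => ?_) i <;> simp
    have hinner : ∀ w : Fin d → ℝ, ∫ s : ℝ,
        ((fun u : Fin (d + 1) → ℝ => (∏ i, expHalf (u i)) * dirOp (Pi.single 0 1) K (-u))
          ((MeasurableEquiv.piFinSuccAbove (fun _ : Fin (d + 1) => ℝ) 0).symm (s, w)))
        = (∏ i, expHalf (w i)) * K (J (-w)) := by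
      intro w
      have hs : ContDiff ℝ (⊤ : ℕ∞) fun s => K (J (-w) + e0 s) :=
        hKs.comp (contDiff_const.add e0.contDiff)
      have hsc : HasCompactSupport fun s => K (J (-w) + e0 s) := by
        refine hKc.comp_isClosedEmbedding (g := fun s => J (-w) + e0 s) ?_
        refine ((Homeomorph.addLeft (J (-w))).isClosedEmbedding).comp ?_
        refine LinearMap.isClosedEmbedding_of_injective (f := e0.toLinearMap)
          (LinearMap.ker_eq_bot.2 fun a b hab => ?_)
        have : e0 a 0 = e0 b 0 := congrFun hab 0
        simpa [he0] using this
      have h1 := integral_expHalf_mul hs hsc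
      rw [map_zero, add_zero] at h1
      rw [← h1, ← integral_const_mul]
      refine integral_congr_ae (ae_of_all _ fun s => ?_)
      have e1 : (MeasurableEquiv.piFinSuccAbove (fun _ : Fin (d + 1) => ℝ) 0).symm (s, w)
          = Fin.cons s w := by
        simp [MeasurableEquiv.piFinSuccAbove, Fin.insertNthEquiv]
      have e2 := congrFun (dirOps_comp_affine hKs e0 (J (-w)) [1]) (-s)
      have e3 : dirOp (1 : ℝ) (fun s => K (J (-w) + e0 s)) (-s)
          = dirOp (e0 1) K (J (-w) + e0 (-s)) := e2
      have e4 : e0 1 = Pi.single 0 1 := by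
        simp [e0, ContinuousLinearMap.toSpanSingleton_apply]
      simp only [e1, hcons, e3, e4, Fin.prod_univ_succ, Fin.cons_zero, Fin.cons_succ]
      ring
    have hfJ : ContDiff ℝ (⊤ : ℕ∞) fun w => f (0 + J w) :=
      hf.comp (contDiff_const.add J.contDiff)
    have hfJc : HasCompactSupport fun w => f (0 + J w) := by
      have : HasCompactSupport fun w => f (J w) := by
        refine hc.comp_isClosedEmbedding (g := J) ?_
        refine LinearMap.isClosedEmbedding_of_injective (f := J.toLinearMap)
          (LinearMap.ker_eq_bot.2 fun a b hab => ?_)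
        have h : (Fin.cons 0 a : Fin (d + 1) → ℝ) = Fin.cons 0 b := by
          rw [← hJ, ← hJ]; exact hab
        exact (Fin.cons_injective2 h).2
      simpa using this
    have h2 := ih hfJ hfJc
    rw [dirOps_comp_affine hf J 0, List.map_map] at h2
    have hJs : (J ∘ fun i : Fin d => (Pi.single i (1 : ℝ) : Fin d → ℝ))
        = fun i : Fin d => Pi.single i.succ (1 : ℝ) := by
      funext i
      simp only [Function.comp, hJ]
      ext j
      refine Fin.cases ?_ (fun j => ?_) j
      · simp
      · by_cases hij : j = i
        · subst hij; simp
        · rw [Fin.cons_succ, Pi.single_eq_of_ne hij,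
            Pi.single_eq_of_ne fun h => hij (Fin.succ_injective _ h)]
    rw [hJs, map_zero, add_zero] at h2
    simp only [zero_add] at h2
    rw [← h2]
    exact integral_congr_ae (ae_of_all _ fun w => hinner w)

/-- The product kernel `∏ 1_{u_i > 0} e^{-u_i}` on `ℝ^d`. -/
noncomputable def expKernel {d : ℕ} (u : Space d) : ℝ := ∏ i, expHalf (u i)

theorem expKernel_nonneg {d : ℕ} (u : Space d) : 0 ≤ expKernel u := prod_expHalf_nonneg _

theorem expKernel_le_one {d : ℕ} (u : Space d) : expKernel u ≤ 1 := prod_expHalf_le_one _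

theorem measurable_expKernel {d : ℕ} : Measurable (expKernel (d := d)) :=
  measurable_prod_expHalf.comp (EuclideanSpace.volume_preserving_symm_measurableEquiv_toLp
    (Fin d)).measurable

theorem integrable_expKernel_sq {d : ℕ} : Integrable fun u : Space d => expKernel u ^ 2 := by
  have h : Integrable (expKernel (d := d)) := by
    have h1 : Integrable fun u : Fin d → ℝ => ∏ i, expHalf (u i) :=
      Integrable.fintype_prod fun _ => integrable_expHalf
    exact ((EuclideanSpace.volume_preserving_symm_measurableEquiv_toLp
      (Fin d)).integrable_comp_emb (MeasurableEquiv.measurableEmbedding _)).2 h1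
  refine h.mono (measurable_expKernel.pow_const 2).aestronglyMeasurable (ae_of_all _ fun u => ?_)
  have h0 := expKernel_nonneg u
  have h1 := expKernel_le_one u
  rw [Real.norm_eq_abs, Real.norm_eq_abs, abs_of_nonneg h0, abs_of_nonneg (by positivity)]
  nlinarith

/-- Every smooth function with compact support is the convolution of `expKernel` with a smooth
function with compact support. -/
theorem exists_expKernel_convolution {d : ℕ} {f : Space d → ℝ} (hf : ContDiff ℝ (⊤ : ℕ∞) f)
    (hc : HasCompactSupport f) :
    ∃ k : Space d → ℝ, ContDiff ℝ (⊤ : ℕ∞) k ∧ HasCompactSupport k ∧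
      ∀ x, ∫ u, expKernel u * k (x - u) = f x := by
  let L : (Fin d → ℝ) ≃L[ℝ] Space d := (EuclideanSpace.equiv (Fin d) ℝ).symm
  -- The witness is $\prod_i(1+\partial_i)f$; the identity at `x` is the previous lemma for
  -- $w\mapsto f(x+w)$.
  refine ⟨dirOps (((List.finRange d).map fun i => Pi.single i (1 : ℝ)).map L) f,
    contDiff_dirOps hf _, hasCompactSupport_dirOps hc _, fun x => ?_⟩
  have h1 : ContDiff ℝ (⊤ : ℕ∞) fun w => f (x + L w) :=
    hf.comp (contDiff_const.add L.contDiff)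
  have h2 : HasCompactSupport fun w => f (x + L w) :=
    hc.comp_homeomorph (L.toHomeomorph.trans (Homeomorph.addLeft x))
  have h3 := integral_prod_expHalf_mul_dirOps h1 h2
  have h4 := dirOps_comp_affine hf (L : (Fin d → ℝ) →L[ℝ] Space d) x
    ((List.finRange d).map fun i => Pi.single i (1 : ℝ))
  simp only [ContinuousLinearEquiv.coe_coe] at h4
  rw [h4, map_zero, add_zero] at h3
  rw [← h3, ← (EuclideanSpace.volume_preserving_symm_measurableEquiv_toLp (Fin d)).integral_comp
    (MeasurableEquiv.measurableEmbedding _)]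
  refine integral_congr_ae (ae_of_all _ fun u => ?_)
  simp only [map_neg, ← sub_eq_add_neg]
  rfl

/-! ### Integral operators of Hilbert–Schmidt type -/

section HilbertSchmidt

variable {d : ℕ}

/-- A square integrable kernel defines a bounded operator that maps every Hilbert basis to a square
summable family. -/
theorem exists_hilbertSchmidt {κ : Space d → Space d → ℝ} (hm : Measurable (Function.uncurry κ))
    (hκ : ∀ z, MemLp (κ z) 2 volume)
    (hint : Integrable (fun z => ∫ y, κ z y ^ 2)) :
    ∃ A : SpaceL2 d →L[ℝ] SpaceL2 d, (∀ h, A h =ᵐ[volume] fun z => ∫ y, κ z y * h y) ∧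
      ∀ (ι : Type) (b : ι → SpaceL2 d), Orthonormal ℝ b →
        ∀ s : Finset ι, ∑ j ∈ s, ‖A (b j)‖ ^ 2 ≤ ∫ z, ∫ y, κ z y ^ 2 := by
  let G : Space d → SpaceL2 d := fun z => (hκ z).toLp _
  have hGin : ∀ z (h : SpaceL2 d), inner ℝ (G z) h = ∫ y, κ z y * h y := fun z h => by
    rw [inner_eq_integral_mul]
    refine integral_congr_ae ?_
    filter_upwards [(hκ z).coeFn_toLp] with y hy
    rw [hy]
  have hGn : ∀ z, ‖G z‖ ^ 2 = ∫ y, κ z y ^ 2 := fun z => by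
    rw [← real_inner_self_eq_norm_sq, hGin]
    refine integral_congr_ae ?_
    filter_upwards [(hκ z).coeFn_toLp] with y hy
    rw [hy, sq]
  have hGm : ∀ h : SpaceL2 d, StronglyMeasurable fun z => inner ℝ (G z) h := fun h => by
    simp only [hGin]
    have : StronglyMeasurable fun p : Space d × Space d => κ p.1 p.2 * h p.2 :=
      hm.stronglyMeasurable.mul ((Lp.stronglyMeasurable h).comp_measurable measurable_snd)
    exact this.integral_prod_right
  have hle : ∀ z (h : SpaceL2 d), (inner ℝ (G z) h) ^ 2 ≤ ‖G z‖ ^ 2 * ‖h‖ ^ 2 := fun z h => by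
    rw [← mul_pow, ← sq_abs]
    gcongr
    exact abs_real_inner_le_norm _ _
  simp only [← hGn] at hint ⊢
  have hsq : ∀ h : SpaceL2 d, Integrable fun z => (inner ℝ (G z) h) ^ 2 := fun h => by
    refine (hint.mul_const (‖h‖ ^ 2)).mono' ((hGm h).pow 2).aestronglyMeasurable
      (ae_of_all _ fun z => ?_)
    rw [Real.norm_eq_abs, abs_of_nonneg (sq_nonneg _)]
    exact hle z h
  have hL : ∀ h : SpaceL2 d, MemLp (fun z => inner ℝ (G z) h) 2 volume := fun h =>
    (memLp_two_iff_integrable_sq (hGm h).aestronglyMeasurable).2 (hsq h)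
  let A0 : SpaceL2 d → SpaceL2 d := fun h => (hL h).toLp _
  have hA0 : ∀ h, A0 h =ᵐ[volume] fun z => inner ℝ (G z) h := fun h => (hL h).coeFn_toLp
  have hnorm : ∀ h, ‖A0 h‖ ^ 2 = ∫ z, (inner ℝ (G z) h) ^ 2 := fun h => by
    rw [← real_inner_self_eq_norm_sq, inner_eq_integral_mul]
    refine integral_congr_ae ?_
    filter_upwards [hA0 h] with z hz
    rw [hz, sq]
  let A1 : SpaceL2 d →ₗ[ℝ] SpaceL2 d :=
    { toFun := A0
      map_add' := fun h h' => by
        apply Lp.ext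
        filter_upwards [hA0 h, hA0 h', hA0 (h + h'), Lp.coeFn_add (A0 h) (A0 h')] with z a b c e
        rw [e, c, Pi.add_apply, a, b, inner_add_right]
      map_smul' := fun r h => by
        apply Lp.ext
        filter_upwards [hA0 h, hA0 (r • h), Lp.coeFn_smul r (A0 h)] with z a b c
        rw [b, RingHom.id_apply, c, Pi.smul_apply, a, inner_smul_right, smul_eq_mul] }
  have hbd : ∀ h, ‖A1 h‖ ≤ Real.sqrt (∫ z, ‖G z‖ ^ 2) * ‖h‖ := fun h => by
    refine le_of_sq_le_sq ?_ (by positivity)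
    change ‖A0 h‖ ^ 2 ≤ _
    rw [mul_pow, Real.sq_sqrt (integral_nonneg fun z => by positivity), hnorm,
      ← integral_mul_const]
    exact integral_mono (hsq h) (hint.mul_const _) fun z => hle z h
  refine ⟨A1.mkContinuous _ hbd, fun h => ?_, fun ι b hb s => ?_⟩
  · refine (hA0 h).trans (ae_of_all _ fun z => ?_)
    exact hGin z h
  · change ∑ j ∈ s, ‖A0 (b j)‖ ^ 2 ≤ _
    simp only [hnorm]
    rw [← integral_finsetSum _ fun j _ => hsq (b j)]
    refine integral_mono (integrable_finsetSum _ fun j _ => hsq (b j)) hint fun z => ?_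
    -- Bessel's inequality for the single vector `G z`; integrating over `z` gives the
    -- Hilbert–Schmidt bound.
    have := hb.sum_inner_products_le (x := G z) (s := s)
    refine le_trans (le_of_eq ?_) this
    refine Finset.sum_congr rfl fun j _ => ?_
    rw [Real.norm_eq_abs, sq_abs, real_inner_comm]

/-- A positive continuous square integrable weight. -/
noncomputable def weight (y : Space d) : ℝ := (1 + ‖y‖) ^ (-((d : ℝ) + 1))

theorem weight_pos (y : Space d) : 0 < weight y := Real.rpow_pos_of_pos (by positivity) _

theorem continuous_weight : Continuous (weight (d := d)) := by
  refine continuous_iff_continuousAt.2 fun y => ?_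
  refine ContinuousAt.rpow_const (by fun_prop) (Or.inl ?_)
  positivity

theorem weight_le_one (y : Space d) : weight y ≤ 1 :=
  Real.rpow_le_one_of_one_le_of_nonpos (by linarith [norm_nonneg y])
    (by have : (0 : ℝ) ≤ d := Nat.cast_nonneg d; linarith)

theorem integrable_weight_sq : Integrable fun y : Space d => weight y ^ 2 := by
  have h : Integrable (weight (d := d)) :=
    integrable_one_add_norm (r := (d : ℝ) + 1) (by simp)
  refine h.mono (continuous_weight.pow 2).aestronglyMeasurable (ae_of_all _ fun u => ?_)
  have h0 := (weight_pos u).le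
  have h1 := weight_le_one u
  rw [Real.norm_eq_abs, Real.norm_eq_abs, abs_of_nonneg h0, abs_of_nonneg (by positivity)]
  nlinarith

/-- The kernel of the smoothing operator. -/
noncomputable def smoothingKernel (z y : Space d) : ℝ := expKernel (y - z) * weight y

theorem measurable_smoothingKernel : Measurable (Function.uncurry (smoothingKernel (d := d))) :=
  (measurable_expKernel.comp (measurable_snd.sub measurable_fst)).mul
    (continuous_weight.measurable.comp measurable_snd)

theorem memLp_smoothingKernel (z : Space d) : MemLp (smoothingKernel z) 2 volume := by
  have hw : MemLp (weight (d := d)) 2 volume :=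
    (memLp_two_iff_integrable_sq continuous_weight.aestronglyMeasurable).2 integrable_weight_sq
  refine hw.mono
    ((measurable_smoothingKernel.comp measurable_prodMk_left).aestronglyMeasurable)
    (ae_of_all _ fun y => ?_)
  rw [smoothingKernel, norm_mul]
  refine mul_le_of_le_one_left (norm_nonneg _) ?_
  rw [Real.norm_eq_abs, abs_of_nonneg (expKernel_nonneg _)]
  exact expKernel_le_one _

/-- Integrating in `z` first removes the dependence of the exponential factor on `y` by translation
invariance; the weight then makes the integral over `y` converge. -/
theorem integrable_smoothingKernel_sq :
    Integrable fun p : Space d × Space d => smoothingKernel p.1 p.2 ^ 2 := by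
  have hm : AEStronglyMeasurable (fun p : Space d × Space d => smoothingKernel p.1 p.2 ^ 2)
      ((volume : Measure (Space d)).prod volume) :=
    (measurable_smoothingKernel.pow_const 2).aestronglyMeasurable
  rw [Measure.volume_eq_prod, integrable_prod_iff' hm]
  have hsub : ∀ y : Space d, Integrable fun z => expKernel (y - z) ^ 2 := fun y =>
    (integrable_expKernel_sq (d := d)).comp_sub_left y
  have hint : ∀ y : Space d, ∫ z, expKernel (y - z) ^ 2 = ∫ u : Space d, expKernel u ^ 2 :=
    fun y => integral_sub_left_eq_self (fun u : Space d => expKernel u ^ 2) volume y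
  constructor
  · refine ae_of_all _ fun y => ?_
    simp only [smoothingKernel, mul_pow]
    exact (hsub y).mul_const _
  · have : (fun y : Space d => ∫ z, ‖smoothingKernel z y ^ 2‖)
        = fun y => (∫ u : Space d, expKernel u ^ 2) * weight y ^ 2 := by
      funext y
      rw [← hint y, ← integral_mul_const]
      refine integral_congr_ae (ae_of_all _ fun z => ?_)
      simp only [smoothingKernel, mul_pow]
      rw [Real.norm_eq_abs, abs_of_nonneg (by positivity)]
    simp only [this]
    exact integrable_weight_sq.const_mul _

theorem exists_smoothingOperator (d : ℕ) :
    ∃ A : SpaceL2 d →L[ℝ] SpaceL2 d,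
      (∀ h, A h =ᵐ[volume] fun z => ∫ y, smoothingKernel z y * h y) ∧
      ∃ V : ℝ, ∀ (ι : Type) (b : ι → SpaceL2 d), Orthonormal ℝ b →
        ∀ s : Finset ι, ∑ j ∈ s, ‖A (b j)‖ ^ 2 ≤ V := by
  have hint := integrable_smoothingKernel_sq (d := d)
  rw [Measure.volume_eq_prod] at hint
  obtain ⟨A, h1, h2⟩ := exists_hilbertSchmidt measurable_smoothingKernel memLp_smoothingKernel
    hint.integral_prod_left
  exact ⟨A, h1, _, h2⟩

/-- Orthonormal vectors are $\sqrt2$ apart, so balls of radius $1/2$ around them are disjoint.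
Countability allows almost surely convergent sequences of partial sums to be extracted. -/
theorem countable_of_orthonormal {H ι : Type*} [NormedAddCommGroup H] [InnerProductSpace ℝ H]
    [TopologicalSpace.SeparableSpace H] {b : ι → H} (hb : Orthonormal ℝ b) : Countable ι := by
  refine Pairwise.countable_of_isOpen_disjoint (s := fun i => Metric.ball (b i) (1 / 2)) ?_
    (fun i => Metric.isOpen_ball) (fun i => ⟨b i, Metric.mem_ball_self (by norm_num)⟩)
  intro i j hij
  refine Metric.ball_disjoint_ball ?_
  have h : ‖b i - b j‖ ^ 2 = 2 := by
    rw [norm_sub_sq_real, hb.1, hb.1, hb.2 hij]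
    norm_num
  rw [dist_eq_norm]
  by_contra hlt
  rw [not_le] at hlt
  nlinarith [norm_nonneg (b i - b j)]

end HilbertSchmidt

/-! ### Hilbert space valued Gaussian series -/

section Series

variable {Ω : Type*} {mΩ : MeasurableSpace Ω} {P : Measure Ω}
  {H : Type*} [NormedAddCommGroup H] [InnerProductSpace ℝ H]

/-- The random vector `ω ↦ Z ω • h`. -/
noncomputable def tensorLp (P : Measure Ω) (h : H) : Lp ℝ 2 P →L[ℝ] Lp H 2 P :=
  (ContinuousLinearMap.toSpanSingleton ℝ h).compLpL 2 P

theorem coeFn_tensorLp (h : H) (Z : Lp ℝ 2 P) : tensorLp P h Z =ᵐ[P] fun ω => Z ω • h := by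
  filter_upwards [(ContinuousLinearMap.toSpanSingleton ℝ h).coeFn_compLpL (p := 2) Z] with ω hω
  rw [tensorLp, hω, ContinuousLinearMap.toSpanSingleton_apply]

theorem inner_tensorLp (h h' : H) (Z Z' : Lp ℝ 2 P) :
    inner ℝ (tensorLp P h Z) (tensorLp P h' Z') = inner ℝ Z Z' * inner ℝ h h' := by
  rw [L2.inner_def, inner_eq_integral_mul, ← integral_mul_const]
  refine integral_congr_ae ?_
  filter_upwards [coeFn_tensorLp h Z, coeFn_tensorLp h' Z'] with ω h1 h2
  rw [h1, h2, inner_smul_left, inner_smul_right]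
  simp only [RCLike.conj_to_real]
  ring

theorem norm_tensorLp {h : H} (hh : ‖h‖ = 1) (Z : Lp ℝ 2 P) : ‖tensorLp P h Z‖ = ‖Z‖ := by
  have : ‖tensorLp P h Z‖ ^ 2 = ‖Z‖ ^ 2 := by
    rw [← real_inner_self_eq_norm_sq, ← real_inner_self_eq_norm_sq, inner_tensorLp,
      real_inner_self_eq_norm_sq h, hh]
    ring
  exact (sq_eq_sq₀ (norm_nonneg _) (norm_nonneg _)).1 this

/-- Orthogonality of the terms in $L^2(\Omega;H)$ comes from the vectors `b j`, so the coefficients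
`D j` may be correlated. -/
theorem summable_tensorLp [CompleteSpace H] {ι : Type*} {b : ι → H} (hb : Orthonormal ℝ b)
    {D : ι → Lp ℝ 2 P} (hD : Summable fun j => ‖D j‖ ^ 2) :
    Summable fun j => tensorLp P (b j) (D j) := by
  let V : ι → Lp ℝ 2 P →ₗᵢ[ℝ] Lp H 2 P := fun j =>
    { toLinearMap := (tensorLp P (b j)).toLinearMap
      norm_map' := fun Z => norm_tensorLp (hb.1 j) Z }
  have hV : OrthogonalFamily ℝ (fun _ : ι => Lp ℝ 2 P) V := fun i j hij Z Z' => by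
    change inner ℝ (tensorLp P (b i) Z) (tensorLp P (b j) Z') = 0
    rw [inner_tensorLp, hb.2 hij, mul_zero]
  exact (hV.summable_iff_norm_sq_summable D).2 hD

theorem norm_sum_smul_sq {ι : Type*} {b : ι → H} (hb : Orthonormal ℝ b) (s : Finset ι)
    (x : ι → ℝ) : ‖∑ j ∈ s, x j • b j‖ ^ 2 = ∑ j ∈ s, x j ^ 2 := by
  rw [← real_inner_self_eq_norm_sq, hb.inner_sum x x s]
  refine Finset.sum_congr rfl fun j _ => ?_
  simp only [RCLike.conj_to_real]
  ring

/-- The fourth moment of a finite Gaussian sum. -/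
theorem lintegral_finset_sum_pow_four_le {ι : Type*} {b : ι → H} (hb : Orthonormal ℝ b)
    {D : ι → Lp ℝ 2 P} {v : ι → ℝ≥0} (hD : ∀ j, HasLaw (D j) (gaussianReal 0 (v j)) P)
    (s : Finset ι) {V : ℝ} (hV : ∑ j ∈ s, (v j : ℝ) ≤ V) :
    ∫⁻ ω, ‖(∑ j ∈ s, tensorLp P (b j) (D j) : Lp H 2 P) ω‖ₑ ^ 4 ∂P
      ≤ ENNReal.ofReal (gaussianFourthMoment * V ^ 2) := by
  have h0 := gaussianFourthMoment_nonneg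
  -- By Parseval the fourth power is $(\sum_jD_j^2)^2$. Minkowski's inequality for $\sum_jD_j^2$ in
  -- $L^2(\Omega)$ then needs only the individual laws and no independence.
  have hpt : ∀ᵐ ω ∂P, ‖(∑ j ∈ s, tensorLp P (b j) (D j) : Lp H 2 P) ω‖ₑ ^ 4
      = ‖(∑ j ∈ s, fun ω => D j ω ^ 2) ω‖ₑ ^ 2 := by
    have h1 : ∀ᵐ ω ∂P, ∀ j ∈ s, tensorLp P (b j) (D j) ω = D j ω • b j :=
      (Finset.eventually_all s).2 fun j _ => coeFn_tensorLp (b j) (D j)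
    filter_upwards [h1, Lp.coeFn_finsetSum s fun j => tensorLp P (b j) (D j)] with ω e1 e2
    rw [e2, Finset.sum_apply, Finset.sum_apply, Finset.sum_congr rfl e1,
      ← norm_sum_smul_sq hb s fun j => D j ω, enorm_pow]
    rw [← pow_mul, enorm_norm]
  have hsq : ∀ f : Ω → ℝ, ∫⁻ ω, ‖f ω‖ₑ ^ 2 ∂P = eLpNorm f 2 P ^ 2 := fun f => by
    have h : eLpNorm f (2 : ℝ≥0) P ^ ((2 : ℝ≥0) : ℝ) = ∫⁻ x, ‖f x‖ₑ ^ ((2 : ℝ≥0) : ℝ) ∂P :=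
      eLpNorm_nnreal_pow_eq_lintegral (p := 2) (by norm_num)
    simpa using h.symm
  have hterm : ∀ j, eLpNorm (fun ω => D j ω ^ 2) 2 P
      = ENNReal.ofReal (Real.sqrt gaussianFourthMoment * v j) := fun j => by
    have e1 : eLpNorm (fun ω => D j ω ^ 2) 2 P ^ 2
        = ENNReal.ofReal (Real.sqrt gaussianFourthMoment * v j) ^ 2 := by
      rw [← hsq, ← ENNReal.ofReal_pow (by positivity), mul_pow, Real.sq_sqrt h0,
        ← lintegral_enorm_pow_four_of_hasLaw (hD j)]
      refine lintegral_congr fun ω => ?_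
      rw [enorm_pow, ← pow_mul]
    exact (ENNReal.pow_right_strictMono (n := 2) (by norm_num)).injective e1
  rw [lintegral_congr_ae hpt, hsq]
  have h2 : eLpNorm (∑ j ∈ s, fun ω => D j ω ^ 2) 2 P
      ≤ ENNReal.ofReal (Real.sqrt gaussianFourthMoment * V) := by
    refine (eLpNorm_sum_le (fun j _ => (memLp_two_sq_of_hasLaw (hD j)).1) (by norm_num)).trans ?_
    simp only [hterm]
    rw [← ENNReal.ofReal_sum_of_nonneg fun j _ => by positivity, ← Finset.mul_sum]
    exact ENNReal.ofReal_le_ofReal (by gcongr)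
  have hV0 : 0 ≤ V := (Finset.sum_nonneg fun j _ => (v j).2).trans hV
  refine (pow_le_pow_left' h2 2).trans (le_of_eq ?_)
  rw [← ENNReal.ofReal_pow (by positivity), mul_pow, Real.sq_sqrt h0]

/-- The fourth moment of a convergent Gaussian series. -/
theorem lintegral_hasSum_pow_four_le {ι : Type*} [Countable ι] {b : ι → H} (hb : Orthonormal ℝ b)
    {D : ι → Lp ℝ 2 P} {v : ι → ℝ≥0} (hD : ∀ j, HasLaw (D j) (gaussianReal 0 (v j)) P)
    {V : ℝ} (hV : ∀ s : Finset ι, ∑ j ∈ s, (v j : ℝ) ≤ V) {Y : Lp H 2 P}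
    (hY : HasSum (fun j => tensorLp P (b j) (D j)) Y) :
    ∫⁻ ω, ‖Y ω‖ₑ ^ 4 ∂P ≤ ENNReal.ofReal (gaussianFourthMoment * V ^ 2) := by
  -- Fatou's lemma along an almost surely convergent sequence of partial sums passes the uniform
  -- bound to the limit.
  obtain ⟨ns, -, hns⟩ := (tendstoInMeasure_of_tendsto_Lp hY).exists_seq_tendsto_ae'
  have h1 : ∀ᵐ ω ∂P, ‖Y ω‖ₑ ^ 4
      = liminf (fun i => ‖(∑ j ∈ ns i, tensorLp P (b j) (D j) : Lp H 2 P) ω‖ₑ ^ 4) atTop := by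
    filter_upwards [hns] with ω hω
    exact (Tendsto.liminf_eq (((ENNReal.continuous_pow 4).tendsto _).comp hω.enorm)).symm
  rw [lintegral_congr_ae h1]
  refine (lintegral_liminf_le fun i => ?_).trans ?_
  · exact (Lp.stronglyMeasurable _).enorm.pow_const 4
  · exact (liminf_le_liminf (Eventually.of_forall fun i =>
      lintegral_finset_sum_pow_four_le hb hD (ns i) (hV _))).trans_eq (liminf_const _)

end Series

/-! ### A continuous Hilbert space valued process -/

section ContinuousVersion

variable {T : ℝ≥0} {d : ℕ} {Ω : Type*} {mΩ : MeasurableSpace Ω} {P : Measure Ω}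
  {Wdot : SpaceTimeL2 T d → Lp ℝ 2 P}

/-- If `A` is Hilbert–Schmidt, then `c ↦ W_t (A c)` is represented by a random element of
`L²(ℝ^d)` that depends continuously on `t`. -/
theorem IsSpaceTimeWhiteNoise.exists_continuous_process [IsProbabilityMeasure P]
    (hW : IsSpaceTimeWhiteNoise P Wdot) (A : SpaceL2 d →L[ℝ] SpaceL2 d) {V : ℝ}
    {ι : Type*} (b : HilbertBasis ι ℝ (SpaceL2 d))
    (hA : ∀ s : Finset ι, ∑ j ∈ s, ‖A (b j)‖ ^ 2 ≤ V) :
    ∃ Y : Time T → Ω → SpaceL2 d, (∀ t, StronglyMeasurable (Y t)) ∧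
      (∀ ω, Continuous fun t => Y t ω) ∧
      ∀ t c, (fun ω => inner ℝ c (Y t ω)) =ᵐ[P] cylindricalWiener Wdot t (A c) := by
  have hcount : Countable ι := by
    have : Fact ((2 : ℝ≥0∞) ≠ ∞) := ⟨by norm_num⟩
    exact countable_of_orthonormal b.orthonormal
  let D : Time T → ι → Lp ℝ 2 P := fun t j => cylindricalWiener Wdot t (A (b j))
  have hV0 : 0 ≤ V := by simpa using hA ∅
  have hsumA : Summable fun j => ‖A (b j)‖ ^ 2 :=
    summable_of_sum_le (fun j => by positivity) hA
  have hsum : ∀ t, Summable fun j => tensorLp P (b j) (D t j) := fun t => by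
    refine summable_tensorLp b.orthonormal ?_
    have : ∀ j, ‖D t j‖ ^ 2 = (t : ℝ≥0) * ‖A (b j)‖ ^ 2 := fun j => by
      rw [← real_inner_self_eq_norm_sq, hW.inner_cylindricalWiener, min_self,
        real_inner_self_eq_norm_sq]
    simp only [this]
    exact hsumA.mul_left _
  choose Z hZ using hsum
  -- Expanding `c` in the basis turns both sides into sums of the same series in $L^2(\Omega)$.
  have hpair : ∀ t c, (fun ω => inner ℝ c (Z t ω)) =ᵐ[P] cylindricalWiener Wdot t (A c) := by
    intro t c
    have h1 := ((innerSL ℝ c).compLpL 2 P).hasSum (hZ t)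
    have h2 := (hW.wienerCLM t ∘L A).hasSum (b.hasSum_repr c)
    have h3 : ∀ j, ((innerSL ℝ c).compLpL 2 P) (tensorLp P (b j) (D t j))
        = (hW.wienerCLM t ∘L A) (b.repr c j • b j) := fun j => by
      rw [map_smul, ContinuousLinearMap.comp_apply, hW.wienerCLM_apply]
      apply Lp.ext
      filter_upwards [(innerSL ℝ c).coeFn_compLpL (p := 2) (tensorLp P (b j) (D t j)),
        coeFn_tensorLp (b j) (D t j),
        Lp.coeFn_smul (b.repr c j) (cylindricalWiener Wdot t (A (b j)))] with ω e1 e2 e3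
      rw [e1, e2, e3, Pi.smul_apply, map_smul, innerSL_apply_apply, b.repr_apply_apply,
        real_inner_comm, smul_eq_mul, smul_eq_mul, mul_comm]
    have h4 : ((innerSL ℝ c).compLpL 2 P) (Z t) = cylindricalWiener Wdot t (A c) := by
      rw [← hW.wienerCLM_apply]
      refine h1.unique ?_
      simpa only [Function.comp_def, h3, ContinuousLinearMap.comp_apply] using h2
    rw [← h4]
    exact ((innerSL ℝ c).coeFn_compLpL (p := 2) (Z t)).symm
  have hmom : ∀ s t : Time T, s ≤ t → ∫⁻ ω, ‖Z t ω - Z s ω‖ₑ ^ 4 ∂P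
      ≤ ENNReal.ofReal (gaussianFourthMoment
        * (V * (((t : ℝ≥0) : ℝ) - ((s : ℝ≥0) : ℝ))) ^ 2) := by
    intro s t hst
    have h3 : ((s : ℝ≥0) : ℝ) ≤ ((t : ℝ≥0) : ℝ) := by exact_mod_cast hst
    have hD : HasSum (fun j => tensorLp P (b j) (D t j - D s j)) (Z t - Z s) := by
      simpa only [map_sub] using (hZ t).sub (hZ s)
    have hlaw : ∀ j, HasLaw ((D t j - D s j : Lp ℝ 2 P) : Ω → ℝ)
        (gaussianReal 0 (‖A (b j)‖₊ ^ 2 * ((t : ℝ≥0) - (s : ℝ≥0)))) P := fun j =>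
      (hW.hasLaw_increment hst (A (b j))).congr (Lp.coeFn_sub _ _)
    have hv : ∀ u : Finset ι, ∑ j ∈ u,
        ((‖A (b j)‖₊ ^ 2 * ((t : ℝ≥0) - (s : ℝ≥0)) : ℝ≥0) : ℝ)
        ≤ V * (((t : ℝ≥0) : ℝ) - ((s : ℝ≥0) : ℝ)) := fun u => by
      have : ∀ j ∈ u, ((‖A (b j)‖₊ ^ 2 * ((t : ℝ≥0) - (s : ℝ≥0)) : ℝ≥0) : ℝ)
          = ‖A (b j)‖ ^ 2 * (((t : ℝ≥0) : ℝ) - ((s : ℝ≥0) : ℝ)) := fun j _ => by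
        rw [coe_sub_of_le hst]
        simp
      rw [Finset.sum_congr rfl this, ← Finset.sum_mul]
      exact mul_le_mul_of_nonneg_right (hA u) (sub_nonneg.2 h3)
    refine le_trans (le_of_eq ?_) (lintegral_hasSum_pow_four_le b.orthonormal hlaw hv hD)
    refine lintegral_congr_ae ?_
    filter_upwards [Lp.coeFn_sub (Z t) (Z s)] with ω hω
    rw [hω, Pi.sub_apply]
  -- Dividing by `T + 1` rather than `T` keeps `F` strictly below one at the final time.
  let F : Time T → ℝ := fun t => ((t : ℝ≥0) : ℝ) / ((T : ℝ) + 1)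
  have hT1 : (0 : ℝ) < (T : ℝ) + 1 := by positivity
  have hsub : ∀ s t, F s - F t = (((s : ℝ≥0) : ℝ) - ((t : ℝ≥0) : ℝ)) / ((T : ℝ) + 1) :=
    fun s t => by simp only [F]; ring
  have hF1 : ∀ s, F s < 1 := fun s => by
    simp only [F]
    rw [div_lt_one hT1]
    have : ((s : ℝ≥0) : ℝ) ≤ T := by exact_mod_cast s.2
    linarith
  have hmom' : ∀ s t, ∫⁻ ω, ‖Z s ω - Z t ω‖ₑ ^ 4 ∂P
      ≤ ENNReal.ofReal (gaussianFourthMoment * (V * ((T : ℝ) + 1)) ^ 2 * (F s - F t) ^ 2) := by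
    intro s t
    have key : gaussianFourthMoment * (V * ((T : ℝ) + 1)) ^ 2 * (F s - F t) ^ 2
        = gaussianFourthMoment * (V * (((s : ℝ≥0) : ℝ) - ((t : ℝ≥0) : ℝ))) ^ 2 := by
      rw [hsub]
      field_simp
    rw [key]
    rcases le_total t s with h | h
    · exact hmom t s h
    · have e1 : ∫⁻ ω, ‖Z s ω - Z t ω‖ₑ ^ 4 ∂P = ∫⁻ ω, ‖Z t ω - Z s ω‖ₑ ^ 4 ∂P :=
        lintegral_congr fun ω => by rw [enorm_sub_rev]
      rw [e1]
      refine (hmom s t h).trans_eq ?_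
      congr 1
      ring
  obtain ⟨Y, hYm, hYv, hYc⟩ := exists_version_uniformContinuous (fun s => by positivity) hF1
    (fun s => Lp.stronglyMeasurable (Z s))
    (by have := gaussianFourthMoment_nonneg; positivity) hmom'
  refine ⟨Y, hYm, fun ω => ?_, fun t c => ?_⟩
  · rw [Metric.continuous_iff]
    intro t ε hε
    obtain ⟨δ, hδ, h⟩ := hYc ω ε hε
    refine ⟨δ, hδ, fun s hs => h s t ?_⟩
    rw [hsub, abs_div, abs_of_pos hT1]
    refine lt_of_le_of_lt (div_le_self (abs_nonneg _) ?_) hs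
    have : (0 : ℝ) ≤ T := T.2
    linarith
  · refine EventuallyEq.trans ?_ (hpair t c)
    filter_upwards [hYv t] with ω hω
    rw [hω]

end ContinuousVersion

/-! ### Bochner integrals of `L²`-valued functions -/

/-- A Bochner integral in `L²` is computed pointwise. -/
theorem coeFn_integral_lp {X Y : Type*} [MeasurableSpace X] [MeasurableSpace Y] {ν : Measure X}
    {μ : Measure Y} [SigmaFinite ν] [SigmaFinite μ] {F : X → Lp ℝ 2 μ} (hF : Integrable F ν)
    {K : X → Y → ℝ} (hK : AEStronglyMeasurable (Function.uncurry K) (ν.prod μ))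
    (hFK : ∀ x, F x =ᵐ[μ] K x) :
    (∫ x, F x ∂ν : Lp ℝ 2 μ) =ᵐ[μ] fun y => ∫ x, K x y ∂ν := by
  -- The two sides are compared by integrating over sets `s` of finite measure. Fubini applies there
  -- since Cauchy–Schwarz bounds $\int_s|K_x|$ by $\|1_s\|\,\|F_x\|$.
  have hprod : ∀ s, MeasurableSet s → μ s < ∞ →
      Integrable (Function.uncurry K) (ν.prod (μ.restrict s)) := by
    intro s hs hμ
    have hKs : AEStronglyMeasurable (Function.uncurry K) (ν.prod (μ.restrict s)) := by
      have h := hK.restrict (s := Set.univ ×ˢ s)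
      rwa [← Measure.prod_restrict, Measure.restrict_univ] at h
    have hLi : ∀ x, IntegrableOn (F x) s μ := fun x =>
      integrableOn_Lp_of_measure_ne_top (F x) (by norm_num) hμ.ne
    rw [integrable_prod_iff hKs]
    refine ⟨ae_of_all _ fun x => (hLi x).congr (ae_restrict_of_ae (hFK x)), ?_⟩
    refine (hF.norm.mul_const (‖indicatorConstLp 2 hs hμ.ne (1 : ℝ)‖)).mono'
      hKs.norm.integral_prod_right' (ae_of_all _ fun x => ?_)
    rw [Real.norm_eq_abs, abs_of_nonneg (integral_nonneg fun y => norm_nonneg _)]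
    have e1 : ∫ y in s, ‖K x y‖ ∂μ = ∫ y in s, |F x| y ∂μ := by
      refine integral_congr_ae (ae_restrict_of_ae ?_)
      filter_upwards [hFK x, Lp.coeFn_abs (F x)] with y h1 h2
      rw [h2, h1, Real.norm_eq_abs]
    change ∫ y in s, ‖K x y‖ ∂μ ≤ _
    rw [e1, ← L2.inner_indicatorConstLp_one (𝕜 := ℝ) hs hμ.ne]
    refine (real_inner_le_norm _ _).trans_eq ?_
    rw [norm_abs_eq_norm, mul_comm]
  refine ae_eq_of_forall_setIntegral_eq_of_sigmaFinite
    (fun s _ hμ => integrableOn_Lp_of_measure_ne_top _ (by norm_num) hμ.ne)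
    (fun s hs hμ => (hprod s hs hμ).integral_prod_right) fun s hs hμ => ?_
  rw [← L2.inner_indicatorConstLp_one (𝕜 := ℝ) hs hμ.ne, ← integral_inner hF,
    ← integral_integral_swap (hprod s hs hμ)]
  refine integral_congr_ae (ae_of_all _ fun x => ?_)
  simp only
  rw [L2.inner_indicatorConstLp_one (𝕜 := ℝ) hs hμ.ne]
  exact integral_congr_ae (ae_restrict_of_ae (hFK x))

/-! ### Translations and mollification in `L²` -/

section Mollify

variable {d : ℕ}

/-- The translate `z ↦ f (y + z)`. -/
noncomputable def shift (y : Space d) (f : SpaceL2 d) : SpaceL2 d :=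
  Lp.compMeasurePreserving (fun z => y + z) (measurePreserving_add_left volume y) f

theorem coeFn_shift (y : Space d) (f : SpaceL2 d) :
    shift y f =ᵐ[volume] fun z => f (y + z) :=
  Lp.coeFn_compMeasurePreserving f (measurePreserving_add_left volume y)

theorem norm_shift (y : Space d) (f : SpaceL2 d) : ‖shift y f‖ = ‖f‖ :=
  Lp.norm_compMeasurePreserving _ _

theorem shift_zero (f : SpaceL2 d) : shift 0 f = f := by
  apply Lp.ext
  filter_upwards [coeFn_shift 0 f] with z hz
  rw [hz, zero_add]

theorem continuous_shift (f : SpaceL2 d) : Continuous fun y => shift y f := by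
  let g : C(Space d, C(Space d, Space d)) :=
    (ContinuousMap.mk (fun a : Space d × Space d => a.1 + a.2) (by fun_prop)).curry
  exact (continuous_const (y := f)).compMeasurePreservingLp g.continuous
    (fun y => measurePreserving_add_left volume y) (by norm_num)

/-- The mollification `z ↦ ∫ r(y) f(y + z) dy` of `f` by a kernel `r`. -/
noncomputable def mollify (r : Space d → ℝ) (f : SpaceL2 d) : SpaceL2 d :=
  ∫ y, r y • shift y f

theorem integrable_smul_shift {r : Space d → ℝ} (hr : Integrable r) (f : SpaceL2 d) :
    Integrable fun y => r y • shift y f :=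
  hr.smul_bdd ‖f‖ (continuous_shift f).aestronglyMeasurable
    (ae_of_all _ fun y => (norm_shift y f).le)

theorem mollify_sub {r : Space d → ℝ} (hr : Integrable r) (f g : SpaceL2 d) :
    mollify r (f - g) = mollify r f - mollify r g := by
  rw [mollify, mollify, mollify, ← integral_sub (integrable_smul_shift hr f)
    (integrable_smul_shift hr g)]
  refine integral_congr_ae (ae_of_all _ fun y => ?_)
  simp only [shift, map_sub, smul_sub]

theorem norm_mollify_le (r : Space d → ℝ) (f : SpaceL2 d) :
    ‖mollify r f‖ ≤ (∫ y, ‖r y‖) * ‖f‖ := by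
  refine (norm_integral_le_integral_norm _).trans_eq ?_
  rw [← integral_mul_const]
  refine integral_congr_ae (ae_of_all _ fun y => ?_)
  simp only [norm_smul, norm_shift]

theorem tendsto_mollify {ι : Type*} {l : Filter ι} {r : Space d → ℝ} (hr : Integrable r)
    {u : ι → SpaceL2 d} {f : SpaceL2 d} (hu : Tendsto u l (𝓝 f)) :
    Tendsto (fun k => mollify r (u k)) l (𝓝 (mollify r f)) := by
  rw [tendsto_iff_norm_sub_tendsto_zero] at hu ⊢
  refine squeeze_zero (fun k => norm_nonneg _) (fun k => ?_)
    (by simpa using hu.const_mul (∫ y, ‖r y‖))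
  rw [← mollify_sub hr]
  exact norm_mollify_le r _

/-- The kernel appears as $r(x-z)$, a correlation; it is the convolution with $r$ only when $r$ is
symmetric. -/
theorem coeFn_mollify {r : Space d → ℝ} (hr : Integrable r) (hm : Measurable r) (f : SpaceL2 d) :
    mollify r f =ᵐ[volume] fun z => ∫ x, f x * r (x - z) := by
  have h := coeFn_integral_lp (integrable_smul_shift hr f) (K := fun y z => r y * f (y + z)) ?_ ?_
  · refine h.trans (ae_of_all _ fun z => ?_)
    simp only
    rw [← integral_add_right_eq_self (fun x => f x * r (x - z)) z]
    refine integral_congr_ae (ae_of_all _ fun y => ?_)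
    simp only [add_sub_cancel_right]
    ring
  · have h1 : Measurable fun p : Space d × Space d => f (p.1 + p.2) :=
      (Lp.stronglyMeasurable f).measurable.comp (measurable_fst.add measurable_snd)
    exact ((hm.comp measurable_fst).mul h1).aestronglyMeasurable
  · intro y
    filter_upwards [coeFn_shift y f, Lp.coeFn_smul (r y) (shift y f)] with z h1 h2
    rw [h2, Pi.smul_apply, h1, smul_eq_mul]

/-! ### Properties of the mollifiers -/

variable {ρ : Space d → ℝ}

theorem pnat_cast_pos (n : ℕ+) : (0 : ℝ) < (n : ℝ) := by exact_mod_cast n.pos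

theorem IsMollifierKernel.contDiff_mollifier (hρ : IsMollifierKernel ρ) (n : ℕ+) :
    ContDiff ℝ (⊤ : ℕ∞) (mollifier ρ n) := by
  have := hρ.smooth
  unfold mollifier
  exact contDiff_const.mul (this.comp (contDiff_const_smul (n : ℝ)))

theorem IsMollifierKernel.hasCompactSupport_mollifier (hρ : IsMollifierKernel ρ) (n : ℕ+) :
    HasCompactSupport (mollifier ρ n) :=
  (hρ.compact_support.comp_homeomorph
    (Homeomorph.smulOfNeZero (n : ℝ) (pnat_cast_pos n).ne')).mul_left

theorem IsMollifierKernel.integrable_mollifier (hρ : IsMollifierKernel ρ) (n : ℕ+) :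
    Integrable (mollifier ρ n) :=
  (hρ.contDiff_mollifier n).continuous.integrable_of_hasCompactSupport
    (hρ.hasCompactSupport_mollifier n)

theorem IsMollifierKernel.mollifier_nonneg (hρ : IsMollifierKernel ρ) (n : ℕ+) (x : Space d) :
    0 ≤ mollifier ρ n x :=
  mul_nonneg (by positivity) (hρ.nonneg _)

theorem IsMollifierKernel.mollifier_neg (hρ : IsMollifierKernel ρ) (n : ℕ+) (x : Space d) :
    mollifier ρ n (-x) = mollifier ρ n x := by
  rw [mollifier, mollifier, smul_neg, hρ.symm]

theorem integral_comp_natCast_smul (g : Space d → ℝ) (n : ℕ+) :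
    ∫ x, g ((n : ℝ) • x) = ((n : ℝ) ^ d)⁻¹ * ∫ x, g x := by
  have := Measure.integral_comp_smul_of_nonneg (volume : Measure (Space d)) g (n : ℝ)
    (hR := (pnat_cast_pos n).le)
  simpa using this

theorem IsMollifierKernel.integral_mollifier (hρ : IsMollifierKernel ρ) (n : ℕ+) :
    ∫ x, mollifier ρ n x = 1 := by
  have h := pnat_cast_pos n
  simp only [mollifier]
  rw [integral_const_mul, integral_comp_natCast_smul, hρ.integral_eq_one, mul_one,
    mul_inv_cancel₀ (by positivity)]

theorem IsMollifierKernel.norm_translate_sq (hρ : IsMollifierKernel ρ) (n : ℕ+) (x : Space d) :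
    ‖hρ.translate n x‖₊ ^ 2 = (∫ y, ρ y ^ 2).toNNReal * (n : ℝ≥0) ^ d := by
  have h := pnat_cast_pos n
  apply NNReal.eq
  have h1 : ‖hρ.translate n x‖ ^ 2 = ∫ y, mollifier ρ n (x - y) ^ 2 := by
    rw [← real_inner_self_eq_norm_sq, inner_eq_integral_mul]
    refine integral_congr_ae ?_
    filter_upwards [(hρ.memLp_translate n x).coeFn_toLp] with y hy
    rw [IsMollifierKernel.translate, hy, sq]
  rw [integral_sub_left_eq_self (fun u => mollifier ρ n u ^ 2) volume x] at h1
  simp only [mollifier, mul_pow] at h1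
  rw [integral_const_mul, integral_comp_natCast_smul fun u => ρ u ^ 2] at h1
  push_cast
  rw [h1, Real.coe_toNNReal _ (integral_nonneg fun y => sq_nonneg _)]
  field_simp

theorem IsMollifierKernel.exists_radius (hρ : IsMollifierKernel ρ) :
    ∃ R : ℝ, 0 < R ∧ ∀ (n : ℕ+) x, R ≤ (n : ℝ) * ‖x‖ → mollifier ρ n x = 0 := by
  obtain ⟨R, hR⟩ := hρ.compact_support.isCompact.isBounded.subset_closedBall 0
  refine ⟨max R 0 + 1, by positivity, fun n x hx => ?_⟩
  refine mul_eq_zero_of_right _ (image_eq_zero_of_notMem_tsupport fun hmem => ?_)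
  have h1 := hR hmem
  rw [mem_closedBall_zero_iff, norm_smul, Real.norm_eq_abs,
    abs_of_pos (pnat_cast_pos n)] at h1
  linarith [le_max_left R 0]

/-- Mollifications converge in `L²`. -/
theorem IsMollifierKernel.tendsto_mollify_mollifier (hρ : IsMollifierKernel ρ) (f : SpaceL2 d) :
    Tendsto (fun n : ℕ+ => mollify (mollifier ρ n) f) atTop (𝓝 f) := by
  obtain ⟨R, hR0, hR⟩ := hρ.exists_radius
  rw [Metric.tendsto_atTop]
  intro ε hε
  have hc := (continuous_shift f).tendsto 0
  rw [shift_zero] at hc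
  obtain ⟨δ, hδ, hδ'⟩ := Metric.tendsto_nhds_nhds.1 hc (ε / 2) (by positivity)
  obtain ⟨N, hN⟩ := exists_nat_gt (R / δ)
  refine ⟨⟨N + 1, Nat.succ_pos N⟩, fun n hn => ?_⟩
  have hn' : (N : ℝ) ≤ n := by
    have : N + 1 ≤ (n : ℕ) := hn
    exact_mod_cast (Nat.le_succ N).trans this
  have hi := hρ.integrable_mollifier n
  -- As $\rho_n$ has integral one, the error is an average of `shift y f - f` over $|y|<R/n$, and
  -- $N>R/\delta$ puts these `y` inside the ball of radius `δ`.
  have e1 : mollify (mollifier ρ n) f - f = ∫ y, mollifier ρ n y • (shift y f - f) := by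
    have e2 : f = ∫ y, mollifier ρ n y • f := by
      rw [integral_smul_const, hρ.integral_mollifier, one_smul]
    conv_lhs => rw [mollify]; rhs; rw [e2]
    rw [← integral_sub (integrable_smul_shift hi f) (hi.smul_const f)]
    simp only [smul_sub]
  have hpt : ∀ y, ‖mollifier ρ n y • (shift y f - f)‖ ≤ mollifier ρ n y * (ε / 2) := by
    intro y
    rw [norm_smul, Real.norm_eq_abs, abs_of_nonneg (hρ.mollifier_nonneg n y)]
    rcases le_or_gt R ((n : ℝ) * ‖y‖) with h | h
    · rw [hR n y h, zero_mul, zero_mul]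
    · refine mul_le_mul_of_nonneg_left ?_ (hρ.mollifier_nonneg n y)
      rw [← dist_eq_norm]
      refine (hδ' ?_).le
      rw [dist_zero_right]
      have h1 : R < δ * N := by rwa [div_lt_iff₀ hδ, mul_comm] at hN
      have h2 : δ * N ≤ δ * n := by gcongr
      by_contra hcon
      rw [not_lt] at hcon
      have h3 := mul_le_mul_of_nonneg_left hcon (pnat_cast_pos n).le
      linarith
  rw [dist_eq_norm, e1]
  refine lt_of_le_of_lt (norm_integral_le_of_norm_le (hi.mul_const (ε / 2))
    (ae_of_all _ hpt)) ?_
  rw [integral_mul_const, hρ.integral_mollifier]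
  linarith

end Mollify

/-! ### The smooth random field -/

section Field

variable {d : ℕ} {k : Space d → ℝ}

theorem memLp_fieldVec (hk : Continuous k) (hc : HasCompactSupport k) (x : Space d) :
    MemLp (fun y => (weight y)⁻¹ * k (x - y)) 2 volume := by
  have h1 : Continuous fun y => (weight y)⁻¹ * k (x - y) :=
    (continuous_weight.inv₀ fun y => (weight_pos y).ne').mul (by fun_prop)
  exact h1.memLp_of_hasCompactSupport ((hc.comp_homeomorph (Homeomorph.subLeft x)).mul_left)

/-- The function `y ↦ k(x - y) / weight y` as an element of `L²(ℝ^d)`. -/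
noncomputable def fieldVec (hk : Continuous k) (hc : HasCompactSupport k) (x : Space d) :
    SpaceL2 d :=
  (memLp_fieldVec hk hc x).toLp _

theorem coeFn_fieldVec (hk : Continuous k) (hc : HasCompactSupport k) (x : Space d) :
    fieldVec hk hc x =ᵐ[volume] fun y => (weight y)⁻¹ * k (x - y) :=
  (memLp_fieldVec hk hc x).coeFn_toLp

/-- For `x` in the unit ball around `x₀` the supports stay in one compact ball, so the squared
distance is a continuous parameter integral. This continuity makes the Bochner integrals over
bounded sets available. -/
theorem continuous_fieldVec (hk : Continuous k) (hc : HasCompactSupport k) :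
    Continuous (fieldVec hk hc) := by
  rw [continuous_iff_continuousAt]
  intro x₀
  let q : Space d → Space d → ℝ := fun x y => ((weight y)⁻¹ * (k (x - y) - k (x₀ - y))) ^ 2
  have hnorm : ∀ x, ‖fieldVec hk hc x - fieldVec hk hc x₀‖ ^ 2 = ∫ y, q x y := fun x => by
    rw [← real_inner_self_eq_norm_sq, inner_eq_integral_mul]
    refine integral_congr_ae ?_
    filter_upwards [coeFn_fieldVec hk hc x, coeFn_fieldVec hk hc x₀,
      Lp.coeFn_sub (fieldVec hk hc x) (fieldVec hk hc x₀)] with y h1 h2 h3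
    rw [h3, Pi.sub_apply, h1, h2]
    simp only [q]
    ring
  obtain ⟨R, hR⟩ := hc.isCompact.isBounded.subset_closedBall 0
  have hzero : ∀ x y, x ∈ Metric.closedBall x₀ 1 → y ∉ Metric.closedBall x₀ (R + 1) →
      k (x - y) = 0 := fun x y hx hy => by
    refine image_eq_zero_of_notMem_tsupport fun hmem => hy ?_
    have h1 := hR hmem
    rw [mem_closedBall_zero_iff] at h1
    rw [Metric.mem_closedBall] at hx ⊢
    have h2 := dist_triangle y x x₀
    rw [dist_comm y x, dist_eq_norm x y] at h2
    linarith
  have hcont : ContinuousOn (fun x => ∫ y, q x y) (Metric.closedBall x₀ 1) := by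
    refine continuousOn_integral_of_compact_support (isCompact_closedBall x₀ (R + 1)) ?_ ?_
    · refine Continuous.continuousOn ?_
      have hw : Continuous fun p : Space d × Space d => (weight p.2)⁻¹ :=
        (continuous_weight.comp continuous_snd).inv₀ fun p => (weight_pos p.2).ne'
      exact (hw.mul (by fun_prop)).pow 2
    · intro x y hx hy
      simp only [q]
      rw [hzero x y hx hy, hzero x₀ y (Metric.mem_closedBall_self zero_le_one) hy]
      ring
  have h1 := (hcont.continuousAt (Metric.closedBall_mem_nhds x₀ one_pos)).tendsto
  simp only [← hnorm, sub_self, norm_zero] at h1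
  rw [ContinuousAt, tendsto_iff_norm_sub_tendsto_zero]
  have h2 := (Real.continuous_sqrt.tendsto _).comp h1
  simp only [Function.comp_def, Real.sqrt_sq (norm_nonneg _)] at h2
  simpa using h2

/-- The weight cancels against its inverse, and the substitution $u=y-z$ leaves the convolution of
`expKernel` with `k`. -/
theorem smoothing_fieldVec {A : SpaceL2 d →L[ℝ] SpaceL2 d}
    (hA : ∀ h, A h =ᵐ[volume] fun z => ∫ y, smoothingKernel z y * h y)
    (hk : Continuous k) (hc : HasCompactSupport k) {f : Space d → ℝ}
    (hkf : ∀ x, ∫ u, expKernel u * k (x - u) = f x) (x : Space d) :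
    A (fieldVec hk hc x) =ᵐ[volume] fun z => f (x - z) := by
  refine (hA _).trans (ae_of_all _ fun z => ?_)
  simp only
  rw [← hkf (x - z), ← integral_sub_right_eq_self (fun u => expKernel u * k (x - z - u)) z]
  refine integral_congr_ae ?_
  filter_upwards [coeFn_fieldVec hk hc x] with y hy
  rw [hy, smoothingKernel, show x - z - (y - z) = x - y by abel]
  have := (weight_pos y).ne'
  field_simp

/-- The pairing is the convolution of `k` with the locally integrable function `Y / weight`. As `Y`
is arbitrary, smoothness of the field needs no exceptional set of `ω`. -/
theorem contDiff_inner_fieldVec (hk : ContDiff ℝ (⊤ : ℕ∞) k) (hc : HasCompactSupport k)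
    (Y : SpaceL2 d) :
    ContDiff ℝ (⊤ : ℕ∞) fun x => inner ℝ (fieldVec hk.continuous hc x) Y := by
  have hli : LocallyIntegrable (fun y => (weight y)⁻¹ * Y y) (volume : Measure (Space d)) := by
    rw [← locallyIntegrableOn_univ]
    refine LocallyIntegrableOn.continuousOn_mul ?_ ?_ isOpen_univ.isLocallyClosed
    · exact locallyIntegrableOn_univ.2 ((Lp.memLp Y).locallyIntegrable (by norm_num))
    · exact (continuous_weight.inv₀ fun y => (weight_pos y).ne').continuousOn
  have h := hc.contDiff_convolution_right (ContinuousLinearMap.mul ℝ ℝ) hli hk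
  convert h using 1
  funext x
  rw [inner_eq_integral_mul, convolution_def]
  refine integral_congr_ae ?_
  filter_upwards [coeFn_fieldVec hk.continuous hc x] with y hy
  rw [hy, ContinuousLinearMap.mul_apply']
  ring

theorem integrableOn_smul_fieldVec (hk : Continuous k) (hc : HasCompactSupport k) (φ : SpaceL2 d)
    {B : Set (Space d)} (hB : Bornology.IsBounded B) :
    IntegrableOn (fun x => φ x • fieldVec hk hc x) B := by
  obtain ⟨R, hR⟩ := hB.subset_closedBall 0
  refine IntegrableOn.mono_set ?_ hR
  have h1 : IntegrableOn φ (Metric.closedBall (0 : Space d) R) :=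
    integrableOn_Lp_of_measure_ne_top φ (by norm_num) measure_closedBall_lt_top.ne
  exact h1.smul_continuousOn (continuous_fieldVec hk hc).continuousOn (isCompact_closedBall _ _)

/-- The restriction of `φ` to `B`. -/
noncomputable def restrictLp (φ : SpaceL2 d) {B : Set (Space d)} (hB : MeasurableSet B) :
    SpaceL2 d :=
  ((Lp.memLp φ).indicator hB).toLp _

theorem coeFn_restrictLp (φ : SpaceL2 d) {B : Set (Space d)} (hB : MeasurableSet B) :
    restrictLp φ hB =ᵐ[volume] B.indicator φ :=
  ((Lp.memLp φ).indicator hB).coeFn_toLp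

theorem tendsto_restrictLp (φ : SpaceL2 d) {B : ℕ → Set (Space d)} (hmono : Monotone B)
    (hB : ∀ k, MeasurableSet (B k)) (hU : ⋃ k, B k = Set.univ) :
    Tendsto (fun k => restrictLp φ (hB k)) atTop (𝓝 φ) := by
  have hnorm : ∀ j, ‖restrictLp φ (hB j) - φ‖ ^ 2 = ∫ x, (B j)ᶜ.indicator (fun x => φ x ^ 2) x :=
    fun j => by
    rw [← real_inner_self_eq_norm_sq, inner_eq_integral_mul]
    refine integral_congr_ae ?_
    filter_upwards [coeFn_restrictLp φ (hB j), Lp.coeFn_sub (restrictLp φ (hB j)) φ] with x h1 h2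
    rw [h2, Pi.sub_apply, h1]
    by_cases hx : x ∈ B j
    · simp [hx]
    · simp [hx, sq]
  have hlim : Tendsto (fun j => ∫ x, (B j)ᶜ.indicator (fun x => φ x ^ 2) x) atTop
      (𝓝 (∫ _ : Space d, (0 : ℝ))) := by
    refine tendsto_integral_of_dominated_convergence (fun x => φ x ^ 2) (fun j => ?_)
      (Lp.memLp φ).integrable_sq (fun j => ae_of_all _ fun x => ?_) (ae_of_all _ fun x => ?_)
    · exact (((Lp.memLp φ).1.pow 2).indicator (hB j).compl)
    · by_cases hx : x ∈ B j
      · simp [hx, sq_nonneg]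
      · simp [hx]
    · obtain ⟨j, hj⟩ := Set.mem_iUnion.1 (hU ▸ Set.mem_univ x)
      refine tendsto_const_nhds.congr' ?_
      filter_upwards [eventually_ge_atTop j] with i hi
      rw [Set.indicator_of_notMem]
      simpa using hmono hi hj
  rw [integral_zero] at hlim
  simp only [← hnorm] at hlim
  rw [tendsto_iff_norm_sub_tendsto_zero]
  have h2 := (Real.continuous_sqrt.tendsto _).comp hlim
  simpa only [Function.comp_def, Real.sqrt_sq (norm_nonneg _), Real.sqrt_zero] using h2

/-- Averages of the translates of a kernel are mollifications. -/
theorem smoothing_setIntegral_fieldVec {A : SpaceL2 d →L[ℝ] SpaceL2 d}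
    (hA : ∀ h, A h =ᵐ[volume] fun z => ∫ y, smoothingKernel z y * h y)
    (hk : Continuous k) (hc : HasCompactSupport k) {f : Space d → ℝ} (hf : Continuous f)
    (hfi : Integrable f) (hkf : ∀ x, ∫ u, expKernel u * k (x - u) = f x) (φ : SpaceL2 d)
    {B : Set (Space d)} (hB : Bornology.IsBounded B) (hBm : MeasurableSet B) :
    A (∫ x in B, φ x • fieldVec hk hc x) = mollify f (restrictLp φ hBm) := by
  have hint := integrableOn_smul_fieldVec hk hc φ hB
  -- Inside the integral `A` turns each vector into a translate of `f`; the resulting $L^2$-valued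
  -- integral is then computed pointwise.
  rw [← ContinuousLinearMap.integral_comp_comm A hint]
  apply Lp.ext
  have h1 := coeFn_integral_lp (ν := volume.restrict B) (F := fun x => A (φ x • fieldVec hk hc x))
    (A.integrable_comp hint) (K := fun x z => φ x * f (x - z)) ?_ ?_
  · refine (h1.trans ?_).trans (coeFn_mollify hfi hf.measurable (restrictLp φ hBm)).symm
    refine ae_of_all _ fun z => ?_
    simp only
    rw [← integral_indicator hBm]
    refine integral_congr_ae ?_
    filter_upwards [coeFn_restrictLp φ hBm] with x hx
    rw [hx]
    by_cases h : x ∈ B <;> simp [h]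
  · have h2 : Measurable fun p : Space d × Space d => φ p.1 :=
      (Lp.stronglyMeasurable φ).measurable.comp measurable_fst
    have h3 : Continuous fun p : Space d × Space d => f (p.1 - p.2) := by fun_prop
    exact (h2.mul h3.measurable).aestronglyMeasurable
  · intro x
    rw [map_smul]
    filter_upwards [Lp.coeFn_smul (φ x) (A (fieldVec hk hc x)),
      smoothing_fieldVec hA hk hc hkf x] with z h2 h3
    rw [h2, Pi.smul_apply, h3, smul_eq_mul]

end Field

/-! ### Fourier bounds for differences of mollifications -/

/-- An integrability criterion from Fatou's lemma. -/
theorem integrable_of_tendsto_of_integral_le {α ι : Type*} [MeasurableSpace α] {μ : Measure α}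
    {l : Filter ι} [l.NeBot] [l.IsCountablyGenerated] {G : ι → α → ℝ} {f : α → ℝ} {M : ℝ}
    (hG : ∀ i, Integrable (G i) μ) (h0 : ∀ i x, 0 ≤ G i x) (hM : ∀ i, ∫ x, G i x ∂μ ≤ M)
    (hlim : ∀ x, Tendsto (fun i => G i x) l (𝓝 (f x))) : Integrable f μ := by
  refine ⟨aestronglyMeasurable_of_tendsto_ae l (fun i => (hG i).1) (ae_of_all _ hlim), ?_⟩
  have hbound : ∀ i, ∫⁻ x, ‖G i x‖ₑ ∂μ ≤ ENNReal.ofReal M := fun i => by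
    simp_rw [Real.enorm_of_nonneg (h0 i _)]
    rw [← ofReal_integral_eq_lintegral_ofReal (hG i) (ae_of_all _ (h0 i))]
    exact ENNReal.ofReal_le_ofReal (hM i)
  calc ∫⁻ x, ‖f x‖ₑ ∂μ = ∫⁻ x, liminf (fun i => ‖G i x‖ₑ) l ∂μ :=
        lintegral_congr fun x => (hlim x).enorm.liminf_eq.symm
    _ ≤ liminf (fun i => ∫⁻ x, ‖G i x‖ₑ ∂μ) l := lintegral_liminf_le' fun i => (hG i).1.enorm
    _ ≤ ENNReal.ofReal M := liminf_le_of_frequently_le' (Frequently.of_forall hbound)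
    _ < ∞ := ENNReal.ofReal_lt_top

section Fourier

open scoped FourierTransform SchwartzMap Convolution ContDiff

variable {d : ℕ}

/-- A Schwartz function has integrable variation along rays, with a uniform bound. -/
theorem exists_norm_sub_smul_le (h : 𝓢(Space d, ℂ)) :
    ∃ C : ℝ, 0 ≤ C ∧ ∀ (ξ : Space d) (a b : ℝ), 0 ≤ a → a ≤ b →
      ‖h (b • ξ) - h (a • ξ)‖ ≤ C * ((1 + a * ‖ξ‖)⁻¹ - (1 + b * ‖ξ‖)⁻¹) := by
  -- Schwartz decay bounds the derivative by $C(1+|\eta|)^{-2}$. Along the ray $s\xi$ this is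
  -- dominated by the derivative of $-C(1+s|\xi|)^{-1}$.
  obtain ⟨C, hC⟩ : ∃ C : ℝ, ∀ η : Space d, (1 + ‖η‖) ^ 2 * ‖fderiv ℝ h η‖ ≤ C := by
    refine ⟨2 ^ 2 * (Finset.Iic (2, 1)).sup
      (fun m : ℕ × ℕ => SchwartzMap.seminorm ℝ (E := Space d) (F := ℂ) m.1 m.2) h, fun η => ?_⟩
    have := SchwartzMap.one_add_le_sup_seminorm_apply (𝕜 := ℝ) (m := (2, 1)) (k := 2) (n := 1)
      le_rfl le_rfl h η
    rwa [norm_iteratedFDeriv_one] at this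
  have hC0 : 0 ≤ C := le_trans (by positivity) (hC 0)
  refine ⟨C, hC0, fun ξ a b ha hab => ?_⟩
  have hr : 0 ≤ ‖ξ‖ := norm_nonneg ξ
  have hpos : ∀ s, a ≤ s → 0 < 1 + s * ‖ξ‖ := fun s hs => by
    have : 0 ≤ s * ‖ξ‖ := mul_nonneg (ha.trans hs) hr
    linarith
  have hd : ∀ s : ℝ, HasDerivAt (fun s : ℝ => h (s • ξ) - h (a • ξ))
      (fderiv ℝ h (s • ξ) ξ) s := fun s => by
    have h1 : HasDerivAt (fun s : ℝ => s • ξ) ξ s := by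
      simpa using (hasDerivAt_id s).smul_const ξ
    exact ((h.differentiableAt.hasFDerivAt).comp_hasDerivAt s h1).sub_const _
  have hB : ∀ s, a ≤ s → HasDerivAt (fun s : ℝ => C * ((1 + a * ‖ξ‖)⁻¹ - (1 + s * ‖ξ‖)⁻¹))
      (C * (‖ξ‖ / (1 + s * ‖ξ‖) ^ 2)) s := fun s hs => by
    have h1 : HasDerivAt (fun s : ℝ => 1 + s * ‖ξ‖) ‖ξ‖ s := by
      simpa using ((hasDerivAt_id s).mul_const ‖ξ‖).const_add 1
    have h2 := ((h1.fun_inv (hpos s hs).ne').const_sub ((1 + a * ‖ξ‖)⁻¹)).const_mul C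
    rw [neg_div, neg_neg] at h2
    exact h2
  refine image_norm_le_of_norm_deriv_right_le_deriv_boundary' (a := a) (b := b)
    (f := fun s : ℝ => h (s • ξ) - h (a • ξ)) (f' := fun s => fderiv ℝ h (s • ξ) ξ)
    (B := fun s => C * ((1 + a * ‖ξ‖)⁻¹ - (1 + s * ‖ξ‖)⁻¹))
    (B' := fun s => C * (‖ξ‖ / (1 + s * ‖ξ‖) ^ 2))
    (fun s _ => (hd s).continuousAt.continuousWithinAt) (fun s _ => (hd s).hasDerivWithinAt)
    (by simp) (fun s hs => (hB s hs.1).continuousAt.continuousWithinAt)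
    (fun s hs => (hB s hs.1).hasDerivWithinAt) (fun s hs => ?_) ⟨hab, le_rfl⟩
  have h1 := hC (s • ξ)
  rw [norm_smul, Real.norm_of_nonneg (ha.trans hs.1)] at h1
  have h2 : ‖fderiv ℝ h (s • ξ)‖ ≤ C / (1 + s * ‖ξ‖) ^ 2 := by
    rw [le_div_iff₀ (pow_pos (hpos s hs.1) 2), mul_comm]
    exact h1
  calc ‖fderiv ℝ h (s • ξ) ξ‖ ≤ ‖fderiv ℝ h (s • ξ)‖ * ‖ξ‖ := ContinuousLinearMap.le_opNorm _ _
    _ ≤ C / (1 + s * ‖ξ‖) ^ 2 * ‖ξ‖ := by gcongr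
    _ = C * (‖ξ‖ / (1 + s * ‖ξ‖) ^ 2) := by ring

theorem exists_schwartzMap_coe {f : Space d → ℂ} (hf : ContDiff ℝ ∞ f)
    (hc : HasCompactSupport f) : ∃ S : 𝓢(Space d, ℂ), (S : Space d → ℂ) = f :=
  ⟨hc.toSchwartzMap hf, rfl⟩

/-- Plancherel's identity for the convolution of a compactly supported integrable function with a
smooth compactly supported kernel. -/
theorem integral_norm_sq_fourier_convolution {g r : Space d → ℂ} (hg : Integrable g)
    (hgc : HasCompactSupport g) (hr : ContDiff ℝ ∞ r) (hrc : HasCompactSupport r) :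
    Integrable (fun ξ => ‖𝓕 g ξ‖ ^ 2 * ‖𝓕 r ξ‖ ^ 2) ∧
      ∫ ξ, ‖𝓕 g ξ‖ ^ 2 * ‖𝓕 r ξ‖ ^ 2 = ∫ x, ‖∫ y, g y * r (x - y)‖ ^ 2 := by
  have hs : ContDiff ℝ ∞ (g ⋆[ContinuousLinearMap.mul ℝ ℂ, volume] r) :=
    HasCompactSupport.contDiff_convolution_right (n := ⊤) (ContinuousLinearMap.mul ℝ ℂ) hrc
      hg.locallyIntegrable hr
  have hc : HasCompactSupport (g ⋆[ContinuousLinearMap.mul ℝ ℂ, volume] r) :=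
    HasCompactSupport.convolution (ContinuousLinearMap.mul ℝ ℂ) hgc hrc
  obtain ⟨S, hScoe⟩ := exists_schwartzMap_coe hs hc
  have hS : ∀ x, S x = ∫ y, g y * r (x - y) := fun x => by
    rw [hScoe]
    rfl
  have hScoe' : (S : Space d → ℂ) = g ⋆[ContinuousLinearMap.mul ℂ ℂ, volume] r := by
    ext x
    rw [hS]
    rfl
  have hri : Integrable r := hr.continuous.integrable_of_hasCompactSupport hrc
  have hF : ∀ ξ, ‖(𝓕 S) ξ‖ ^ 2 = ‖𝓕 g ξ‖ ^ 2 * ‖𝓕 r ξ‖ ^ 2 := fun ξ => by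
    rw [SchwartzMap.fourier_coe, hScoe', Real.fourier_mul_convolution_eq hg hri, norm_mul, mul_pow]
  refine ⟨?_, ?_⟩
  · have h2 := (𝓕 S).memLp 2 (volume : Measure (Space d))
    exact h2.norm.integrable_sq.congr (ae_of_all _ hF)
  · have h3 := SchwartzMap.integral_norm_sq_fourier S
    simp only [hF, hS] at h3
    exact h3

variable {ρ : Space d → ℝ}

theorem fourier_mollifier (ρ : Space d → ℝ) (n : ℕ+) (ξ : Space d) :
    𝓕 (fun x => (mollifier ρ n x : ℂ)) ξ = 𝓕 (fun x => (ρ x : ℂ)) ((n : ℝ)⁻¹ • ξ) := by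
  have hn := pnat_cast_pos n
  rw [Real.fourier_eq, Real.fourier_eq]
  have h := Measure.integral_comp_smul (volume : Measure (Space d))
    (fun x => Real.fourierChar (-inner ℝ x ((n : ℝ)⁻¹ • ξ)) • (ρ x : ℂ)) (n : ℝ)
  have hpow : |((n : ℝ) ^ Module.finrank ℝ (Space d))⁻¹| = ((n : ℝ) ^ d)⁻¹ := by
    rw [finrank_euclideanSpace_fin, abs_of_pos (by positivity)]
  rw [hpow] at h
  have h2 : ∫ v : Space d, Real.fourierChar (-inner ℝ v ξ) • (mollifier ρ n v : ℂ)
      = ((n : ℝ) ^ d) • ∫ x, Real.fourierChar (-inner ℝ ((n : ℝ) • x) ((n : ℝ)⁻¹ • ξ)) •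
        (ρ ((n : ℝ) • x) : ℂ) := by
    rw [← integral_smul]
    refine integral_congr_ae (ae_of_all _ fun v => ?_)
    simp only [mollifier, real_inner_smul_left, real_inner_smul_right]
    rw [inv_mul_cancel_left₀ hn.ne', smul_comm]
    congr 1
    push_cast
    rw [Complex.real_smul]
    push_cast
    rfl
  rw [h2, h, smul_smul, mul_inv_cancel₀ (by positivity), one_smul]

/-- The squared distances of the mollifications of a compactly supported function are controlled
by the increments of a bounded monotone function. -/
theorem IsMollifierKernel.exists_monotone_control (hρ : IsMollifierKernel ρ) (φ : SpaceL2 d)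
    {K : Set (Space d)} (hK : IsCompact K) (hφ : ∀ᵐ x, x ∉ K → φ x = 0) :
    ∃ F : ℕ+ → ℝ, Monotone F ∧ (∀ n, 0 ≤ F n) ∧ (∃ M, ∀ n, F n ≤ M) ∧
      ∀ m n, m ≤ n →
        ‖mollify (mollifier ρ n) φ - mollify (mollifier ρ m) φ‖ ^ 2 ≤ F n - F m := by
  -- Compact support makes `φ` integrable, so its Fourier transform is an honest integral.
  set g : Space d → ℂ := K.indicator fun x => (φ x : ℂ) with hg
  have hgi : Integrable g :=
    (integrable_indicator_iff hK.measurableSet).2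
      (integrableOn_Lp_of_measure_ne_top φ (by norm_num) hK.measure_lt_top.ne).ofReal
  have hgc : HasCompactSupport g :=
    HasCompactSupport.intro hK fun x hx => Set.indicator_of_notMem hx _
  have hgφ : ∀ᵐ x, g x = φ x := by
    filter_upwards [hφ] with x hx
    by_cases h : x ∈ K
    · simp [hg, h]
    · simp [hg, h, hx h]
  -- mollification is convolution
  have hmol : ∀ n : ℕ+, (fun x => ((mollify (mollifier ρ n) φ x : ℝ) : ℂ)) =ᵐ[volume]
      fun x => ∫ y, g y * (mollifier ρ n (x - y) : ℂ) := fun n => by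
    filter_upwards [coeFn_mollify (hρ.integrable_mollifier n)
      (hρ.contDiff_mollifier n).continuous.measurable φ] with x hx
    rw [hx, ← integral_complex_ofReal]
    refine integral_congr_ae ?_
    filter_upwards [hgφ] with y hy
    rw [hy, ← hρ.mollifier_neg n (x - y), neg_sub]
    push_cast
    rfl
  have hsmooth : ∀ n : ℕ+, ContDiff ℝ ∞ fun x => (mollifier ρ n x : ℂ) := fun n =>
    Complex.ofRealCLM.contDiff.comp (hρ.contDiff_mollifier n)
  have hsupp : ∀ n : ℕ+, HasCompactSupport fun x => (mollifier ρ n x : ℂ) := fun n =>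
    (hρ.hasCompactSupport_mollifier n).comp_left (g := fun x : ℝ => (x : ℂ)) Complex.ofReal_zero
  have hnorm : ∀ f : SpaceL2 d, ‖f‖ ^ 2 = ∫ x, ‖((f x : ℝ) : ℂ)‖ ^ 2 := fun f => by
    rw [← real_inner_self_eq_norm_sq, inner_eq_integral_mul]
    refine integral_congr_ae (ae_of_all _ fun x => ?_)
    simp only [Complex.norm_real, Real.norm_eq_abs, sq_abs]
    ring
  have hintg : ∀ (n : ℕ+) x, Integrable fun y => g y * (mollifier ρ n (x - y) : ℂ) :=
    fun n x => by
    have h1 : Continuous fun y => (mollifier ρ n (x - y) : ℂ) :=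
      (hsmooth n).continuous.comp (continuous_const.sub continuous_id)
    obtain ⟨M, hM⟩ := (hsmooth n).continuous.bounded_above_of_compact_support (hsupp n)
    exact hgi.mul_bdd h1.aestronglyMeasurable (ae_of_all _ fun y => hM (x - y))
  -- Fourier side
  obtain ⟨H, hHcoe⟩ := exists_schwartzMap_coe (f := fun x => (ρ x : ℂ))
    (Complex.ofRealCLM.contDiff.comp hρ.smooth)
    (hρ.compact_support.comp_left (g := fun x : ℝ => (x : ℂ)) Complex.ofReal_zero)
  have hH : ∀ (n : ℕ+) ξ, 𝓕 (fun x => (mollifier ρ n x : ℂ)) ξ = (𝓕 H) ((n : ℝ)⁻¹ • ξ) :=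
    fun n ξ => by rw [fourier_mollifier, SchwartzMap.fourier_coe, hHcoe]
  have hH0 : (𝓕 H) 0 = 1 := by
    rw [SchwartzMap.fourier_coe, hHcoe, Real.fourier_eq]
    simp only [inner_zero_right, neg_zero, AddChar.map_zero_eq_one, one_smul]
    rw [integral_complex_ofReal, hρ.integral_eq_one, Complex.ofReal_one]
  have hpl : ∀ n : ℕ+, Integrable (fun ξ => ‖𝓕 g ξ‖ ^ 2 * ‖(𝓕 H) ((n : ℝ)⁻¹ • ξ)‖ ^ 2) ∧
      ∫ ξ, ‖𝓕 g ξ‖ ^ 2 * ‖(𝓕 H) ((n : ℝ)⁻¹ • ξ)‖ ^ 2 = ‖mollify (mollifier ρ n) φ‖ ^ 2 :=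
    fun n => by
    obtain ⟨h1, h2⟩ := integral_norm_sq_fourier_convolution hgi hgc (hsmooth n) (hsupp n)
    simp only [hH] at h1 h2
    refine ⟨h1, h2.trans ?_⟩
    rw [hnorm]
    refine integral_congr_ae ?_
    filter_upwards [hmol n] with x hx
    rw [hx]
  have hdiff : ∀ m n : ℕ+, Integrable (fun ξ => ‖𝓕 g ξ‖ ^ 2 *
      ‖(𝓕 H) ((n : ℝ)⁻¹ • ξ) - (𝓕 H) ((m : ℝ)⁻¹ • ξ)‖ ^ 2) ∧
      ‖mollify (mollifier ρ n) φ - mollify (mollifier ρ m) φ‖ ^ 2 =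
      ∫ ξ, ‖𝓕 g ξ‖ ^ 2 * ‖(𝓕 H) ((n : ℝ)⁻¹ • ξ) - (𝓕 H) ((m : ℝ)⁻¹ • ξ)‖ ^ 2 := fun m n => by
    obtain ⟨h1, h2⟩ := integral_norm_sq_fourier_convolution hgi hgc ((hsmooth n).sub (hsmooth m))
      ((hsupp n).sub (hsupp m))
    have h3 : ∀ ξ, 𝓕 ((fun x => (mollifier ρ n x : ℂ)) - fun x => (mollifier ρ m x : ℂ)) ξ
        = (𝓕 H) ((n : ℝ)⁻¹ • ξ) - (𝓕 H) ((m : ℝ)⁻¹ • ξ) := fun ξ => by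
      rw [← hH, ← hH, Real.fourier_eq, Real.fourier_eq, Real.fourier_eq, ← integral_sub]
      · simp only [Pi.sub_apply, smul_sub]
      · exact (Real.fourierIntegral_convergent_iff ξ).2
          ((hsmooth n).continuous.integrable_of_hasCompactSupport (hsupp n))
      · exact (Real.fourierIntegral_convergent_iff ξ).2
          ((hsmooth m).continuous.integrable_of_hasCompactSupport (hsupp m))
    have h4 : (fun x => (mollifier ρ n x : ℂ) - (mollifier ρ m x : ℂ)) =
      ((fun x => (mollifier ρ n x : ℂ)) - fun x => (mollifier ρ m x : ℂ)) := rfl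
    simp only [h4, h3] at h1 h2
    refine ⟨h1, ?_⟩
    rw [h2, hnorm]
    refine integral_congr_ae ?_
    filter_upwards [hmol n, hmol m, Lp.coeFn_sub (mollify (mollifier ρ n) φ)
      (mollify (mollifier ρ m) φ)] with x hn hm hs
    rw [hs, Pi.sub_apply, Complex.ofReal_sub, hn, hm, ← integral_sub (hintg n x) (hintg m x)]
    simp only [mul_sub]
  -- Square integrability of $\hat g$ follows by Fatou from $\|\rho_n*\varphi\|\le\|\varphi\|$ and
  -- $\hat\rho(\xi/n)\to\hat\rho(0)=1$.
  have hg2 : Integrable fun ξ => ‖𝓕 g ξ‖ ^ 2 := by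
    refine integrable_of_tendsto_of_integral_le (l := atTop) (fun n => (hpl n).1)
      (fun n ξ => by positivity) (M := ‖φ‖ ^ 2) (fun n => ?_) (fun ξ => ?_)
    · rw [(hpl n).2]
      refine pow_le_pow_left₀ (norm_nonneg _) ?_ 2
      have h2 := norm_mollify_le (mollifier ρ n) φ
      simp_rw [Real.norm_of_nonneg (hρ.mollifier_nonneg n _)] at h2
      rwa [hρ.integral_mollifier, one_mul] at h2
    · have h1 : Tendsto (fun n : ℕ+ => (n : ℝ)⁻¹ • ξ) atTop (𝓝 0) := by
        simpa using (tendsto_inv_atTop_zero.comp ((tendsto_natCast_atTop_atTop (R := ℝ)).comp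
          tendsto_PNat_val_atTop_atTop)).smul_const ξ
      have h2 := ((((𝓕 H).continuous.tendsto 0).comp h1).norm.pow 2).const_mul (‖𝓕 g ξ‖ ^ 2)
      rw [hH0, norm_one, one_pow, mul_one] at h2
      exact h2
  obtain ⟨C, hC0, hC⟩ := exists_norm_sub_smul_le (𝓕 H)
  have hcn : ∀ (n : ℕ+) (ξ : Space d), 0 < (1 + (n : ℝ)⁻¹ * ‖ξ‖)⁻¹ ∧
      (1 + (n : ℝ)⁻¹ * ‖ξ‖)⁻¹ ≤ 1 := fun n ξ => by
    have h1 : 0 ≤ (n : ℝ)⁻¹ * ‖ξ‖ := by positivity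
    exact ⟨by positivity, inv_le_one_of_one_le₀ (by linarith)⟩
  have hFi : ∀ n : ℕ+, Integrable fun ξ => ‖𝓕 g ξ‖ ^ 2 * (1 + (n : ℝ)⁻¹ * ‖ξ‖)⁻¹ := fun n => by
    refine hg2.mul_bdd (c := 1) ?_ (ae_of_all _ fun ξ => ?_)
    · refine Continuous.aestronglyMeasurable (Continuous.inv₀ (by fun_prop) fun ξ => ?_)
      positivity
    · rw [Real.norm_of_nonneg (hcn n ξ).1.le]
      exact (hcn n ξ).2
  have hanti : ∀ (m n : ℕ+) (ξ : Space d), m ≤ n →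
      (1 + (m : ℝ)⁻¹ * ‖ξ‖)⁻¹ ≤ (1 + (n : ℝ)⁻¹ * ‖ξ‖)⁻¹ := fun m n ξ hmn => by
    have h1 : (m : ℝ) ≤ n := by exact_mod_cast hmn
    have := pnat_cast_pos m
    gcongr
  -- The clock integrates $|\hat g|^2$ against $(1+|\xi|/n)^{-1}$, the function that controls
  -- $\hat\rho$ along rays; it increases with `n` and is at most one.
  refine ⟨fun n => C ^ 2 * ∫ ξ, ‖𝓕 g ξ‖ ^ 2 * (1 + (n : ℝ)⁻¹ * ‖ξ‖)⁻¹, fun m n hmn => ?_,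
    fun n => ?_, ⟨C ^ 2 * ∫ ξ, ‖𝓕 g ξ‖ ^ 2, fun n => ?_⟩, fun m n hmn => ?_⟩
  · refine mul_le_mul_of_nonneg_left (integral_mono (hFi m) (hFi n) fun ξ => ?_) (sq_nonneg C)
    exact mul_le_mul_of_nonneg_left (hanti m n ξ hmn) (sq_nonneg _)
  · exact mul_nonneg (sq_nonneg C) (integral_nonneg fun ξ =>
      mul_nonneg (sq_nonneg _) (hcn n ξ).1.le)
  · refine mul_le_mul_of_nonneg_left (integral_mono (hFi n) hg2 fun ξ => ?_) (sq_nonneg C)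
    exact mul_le_of_le_one_right (sq_nonneg _) (hcn n ξ).2
  · rw [(hdiff m n).2]
    simp only
    rw [← mul_sub, ← integral_sub (hFi n) (hFi m), ← integral_const_mul]
    refine integral_mono (hdiff m n).1 (((hFi n).sub (hFi m)).const_mul _) fun ξ => ?_
    simp only
    have h1 : (m : ℝ) ≤ n := by exact_mod_cast hmn
    have hm := pnat_cast_pos m
    have h2 := hC ξ (n : ℝ)⁻¹ (m : ℝ)⁻¹ (by positivity) (by gcongr)
    rw [norm_sub_rev] at h2
    have h3 := sub_nonneg.2 (hanti m n ξ hmn)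
    have h4 := (hcn m ξ).1
    have h5 := (hcn n ξ).2
    have h6 : ‖(𝓕 H) ((n : ℝ)⁻¹ • ξ) - (𝓕 H) ((m : ℝ)⁻¹ • ξ)‖ ^ 2 ≤
        C ^ 2 * ((1 + (n : ℝ)⁻¹ * ‖ξ‖)⁻¹ - (1 + (m : ℝ)⁻¹ * ‖ξ‖)⁻¹) := by
      refine (pow_le_pow_left₀ (norm_nonneg _) h2 2).trans ?_
      rw [mul_pow]
      refine mul_le_mul_of_nonneg_left ?_ (sq_nonneg C)
      -- The difference of the two inverses lies in $[0,1]$, so its square is at most itself.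
      nlinarith
    calc _ ≤ ‖𝓕 g ξ‖ ^ 2 * _ := mul_le_mul_of_nonneg_left h6 (sq_nonneg _)
      _ = _ := by ring

end Fourier

/-! ### Almost sure convergence for compactly supported test functions -/

section Convergence

variable {Ω : Type*} {mΩ : MeasurableSpace Ω} {P : Measure Ω} [IsProbabilityMeasure P]
  {T : ℝ≥0} {d : ℕ} {Wdot : SpaceTimeL2 T d → Lp ℝ 2 P} {ρ : Space d → ℝ}

theorem IsSpaceTimeWhiteNoise.lintegral_enorm_cylindricalWiener_pow_four
    (hW : IsSpaceTimeWhiteNoise P Wdot) (t : Time T) (ψ : SpaceL2 d) :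
    ∫⁻ ω, ‖cylindricalWiener Wdot t ψ ω‖ₑ ^ 4 ∂P
      = ENNReal.ofReal (gaussianFourthMoment * (‖ψ‖ ^ 2 * ((t : ℝ≥0) : ℝ)) ^ 2) := by
  have h := lintegral_enorm_pow_four_of_hasLaw (hW.hasLaw_increment (bot_le (a := t)) ψ)
  have h0 : ((⊥ : Time T) : ℝ≥0) = 0 := rfl
  rw [h0, tsub_zero, NNReal.coe_mul, NNReal.coe_pow, coe_nnnorm] at h
  rw [← h]
  refine lintegral_congr_ae ?_
  filter_upwards [Lp.coeFn_zero ℝ 2 P] with ω hω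
  rw [hW.cylindricalWiener_bot, hω, Pi.zero_apply, sub_zero]

/-- For compactly supported `φ`, the mollified noises `W_t(ρ_n * φ)` converge almost surely. -/
theorem IsSpaceTimeWhiteNoise.ae_tendsto_cylindricalWiener_mollify
    (hW : IsSpaceTimeWhiteNoise P Wdot) (hρ : IsMollifierKernel ρ) (t : Time T) (φ : SpaceL2 d)
    {K : Set (Space d)} (hK : IsCompact K) (hφ : ∀ᵐ x, x ∉ K → φ x = 0) :
    ∀ᵐ ω ∂P, Tendsto (fun n : ℕ+ => cylindricalWiener Wdot t (mollify (mollifier ρ n) φ) ω) atTop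
      (𝓝 (cylindricalWiener Wdot t φ ω)) := by
  obtain ⟨F, hFm, hF0, ⟨M, hM⟩, hF⟩ := hρ.exists_monotone_control φ hK hφ
  have hM0 : 0 ≤ M := (hF0 1).trans (hM 1)
  have hM1 : 0 < M + 1 := by linarith
  have hF' : ∀ m n, ‖mollify (mollifier ρ n) φ - mollify (mollifier ρ m) φ‖ ^ 2 ≤ |F n - F m| :=
    fun m n => by
    rcases le_total m n with h | h
    · exact (hF m n h).trans (le_abs_self _)
    · rw [norm_sub_rev, abs_sub_comm]
      exact (hF n m h).trans (le_abs_self _)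
  -- The index set is `ℕ+`. The fourth moment of an increment is proportional to
  -- $\|\rho_n*\varphi-\rho_m*\varphi\|^4t^2$, hence controlled by $(F(n)-F(m))^2$. Since `F`
  -- converges, uniform continuity with respect to `F` makes the sequence Cauchy.
  obtain ⟨Y, -, hYZ, hY⟩ := exists_version_uniformContinuous (P := P)
    (F := fun n => F n / (M + 1)) (fun n => div_nonneg (hF0 n) hM1.le)
    (fun n => by
      rw [div_lt_one hM1]
      linarith [hM n])
    (Z := fun (n : ℕ+) ω => cylindricalWiener Wdot t (mollify (mollifier ρ n) φ) ω)
    (fun n => Lp.stronglyMeasurable _)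
    (C := gaussianFourthMoment * ((M + 1) * ((t : ℝ≥0) : ℝ)) ^ 2)
    (mul_nonneg gaussianFourthMoment_nonneg (sq_nonneg _)) (fun n m => by
      have h1 : ∫⁻ ω, ‖cylindricalWiener Wdot t (mollify (mollifier ρ n) φ) ω
          - cylindricalWiener Wdot t (mollify (mollifier ρ m) φ) ω‖ₑ ^ 4 ∂P
          = ∫⁻ ω, ‖cylindricalWiener Wdot t
            (mollify (mollifier ρ n) φ - mollify (mollifier ρ m) φ) ω‖ₑ ^ 4 ∂P := by
        refine lintegral_congr_ae ?_
        have h2 : cylindricalWiener Wdot t (mollify (mollifier ρ n) φ - mollify (mollifier ρ m) φ)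
            = cylindricalWiener Wdot t (mollify (mollifier ρ n) φ)
              - cylindricalWiener Wdot t (mollify (mollifier ρ m) φ) := by
          simp only [← hW.wienerCLM_apply, map_sub]
        rw [h2]
        filter_upwards [Lp.coeFn_sub (cylindricalWiener Wdot t (mollify (mollifier ρ n) φ))
          (cylindricalWiener Wdot t (mollify (mollifier ρ m) φ))] with ω hω
        rw [hω, Pi.sub_apply]
      rw [h1, hW.lintegral_enorm_cylindricalWiener_pow_four]
      refine ENNReal.ofReal_le_ofReal ?_
      rw [mul_assoc]
      refine mul_le_mul_of_nonneg_left ?_ gaussianFourthMoment_nonneg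
      have h3 : ((M + 1) * ((t : ℝ≥0) : ℝ)) ^ 2 * (F n / (M + 1) - F m / (M + 1)) ^ 2
          = (|F n - F m| * ((t : ℝ≥0) : ℝ)) ^ 2 := by
        rw [mul_pow |F n - F m|, sq_abs]
        field_simp
      rw [h3]
      exact pow_le_pow_left₀ (by positivity)
        (mul_le_mul_of_nonneg_right (hF' m n) (NNReal.coe_nonneg _)) 2)
  have hconv : Tendsto F atTop (𝓝 (⨆ n, F n)) :=
    tendsto_atTop_ciSup hFm ⟨M, by rintro _ ⟨n, rfl⟩; exact hM n⟩
  have hcauchy : ∀ ω, CauchySeq fun n => Y n ω := fun ω => by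
    rw [Metric.cauchySeq_iff]
    intro ε hε
    obtain ⟨δ, hδ, h⟩ := hY ω ε hε
    obtain ⟨N, hN⟩ := Metric.cauchySeq_iff.1 (hconv.div_const (M + 1)).cauchySeq δ hδ
    exact ⟨N, fun m hm n hn => h m n (hN m hm n hn)⟩
  -- Convergence in $L^2(\Omega)$ identifies the almost sure limit along a subsequence.
  have hLp : Tendsto (fun n : ℕ+ => cylindricalWiener Wdot t (mollify (mollifier ρ n) φ)) atTop
      (𝓝 (cylindricalWiener Wdot t φ)) := by
    simp only [← hW.wienerCLM_apply]
    exact ((hW.wienerCLM t).continuous.tendsto φ).comp (hρ.tendsto_mollify_mollifier φ)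
  obtain ⟨ns, hns, hae⟩ := (tendstoInMeasure_of_tendsto_Lp hLp).exists_seq_tendsto_ae'
  filter_upwards [hae, ae_all_iff.2 hYZ] with ω h1 h2
  obtain ⟨y, hy⟩ := cauchySeq_tendsto_of_complete (hcauchy ω)
  simp only [h2] at hy
  rwa [tendsto_nhds_unique h1 (hy.comp hns)]

end Convergence

/-! ### Spatial integrals of the field -/

section SpatialIntegral

variable {Ω : Type*} {mΩ : MeasurableSpace Ω} {P : Measure Ω}
  {T : ℝ≥0} {d : ℕ} {Wdot : SpaceTimeL2 T d → Lp ℝ 2 P}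
  {A : SpaceL2 d →L[ℝ] SpaceL2 d} {Y : Ω → SpaceL2 d} {k f : Space d → ℝ} {t : Time T}

theorem integrableOn_mul_inner_fieldVec (hk : Continuous k) (hc : HasCompactSupport k)
    (φ : SpaceL2 d) (y : SpaceL2 d) {B : Set (Space d)} (hB : Bornology.IsBounded B) :
    IntegrableOn (fun x => φ x * inner ℝ (fieldVec hk hc x) y) B := by
  refine ((integrableOn_smul_fieldVec hk hc φ hB).inner_const (𝕜 := ℝ) y).congr
    (ae_of_all _ fun x => ?_)
  exact real_inner_smul_left _ _ _

theorem setIntegral_mul_inner_fieldVec (hk : Continuous k) (hc : HasCompactSupport k)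
    (φ : SpaceL2 d) (y : SpaceL2 d) {B : Set (Space d)} (hB : Bornology.IsBounded B) :
    ∫ x in B, φ x * inner ℝ (fieldVec hk hc x) y
      = inner ℝ (∫ x in B, φ x • fieldVec hk hc x) y := by
  rw [real_inner_comm, ← integral_inner (integrableOn_smul_fieldVec hk hc φ hB)]
  refine integral_congr_ae (ae_of_all _ fun x => ?_)
  simp only
  rw [real_inner_comm, real_inner_smul_right]

/-- Integrals of the smoothed field over bounded sets are values of the cylindrical Wiener
process. -/
theorem setIntegral_field_ae_eq
    (hA : ∀ h, A h =ᵐ[volume] fun z => ∫ y, smoothingKernel z y * h y)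
    (hY : ∀ c, (fun ω => inner ℝ c (Y ω)) =ᵐ[P] cylindricalWiener Wdot t (A c))
    (hk : Continuous k) (hc : HasCompactSupport k) (hf : Continuous f)
    (hfi : Integrable f) (hkf : ∀ x, ∫ u, expKernel u * k (x - u) = f x) (φ : SpaceL2 d)
    {B : Set (Space d)} (hB : Bornology.IsBounded B) (hBm : MeasurableSet B) :
    (fun ω => ∫ x in B, φ x * inner ℝ (fieldVec hk hc x) (Y ω)) =ᵐ[P]
      cylindricalWiener Wdot t (mollify f (restrictLp φ hBm)) := by
  rw [← smoothing_setIntegral_fieldVec hA hk hc hf hfi hkf φ hB hBm]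
  simp only [setIntegral_mul_inner_fieldVec hk hc φ _ hB]
  exact hY _

/-- The truncations of `φ` to any exhaustion converge to `φ` in $L^2$, and both mollification and
$W_t$ are continuous, so the limit does not depend on the exhaustion. -/
theorem isSpatialIntegral_field (hW : IsSpaceTimeWhiteNoise P Wdot)
    (hA : ∀ h, A h =ᵐ[volume] fun z => ∫ y, smoothingKernel z y * h y)
    (hY : ∀ c, (fun ω => inner ℝ c (Y ω)) =ᵐ[P] cylindricalWiener Wdot t (A c))
    (hk : Continuous k) (hc : HasCompactSupport k) (hf : Continuous f)
    (hfi : Integrable f) (hkf : ∀ x, ∫ u, expKernel u * k (x - u) = f x) (φ : SpaceL2 d) :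
    IsSpatialIntegral P φ (fun x ω => inner ℝ (fieldVec hk hc x) (Y ω))
      (cylindricalWiener Wdot t (mollify f φ)) := by
  intro B hmono hBm hB hU
  have heq := fun j => setIntegral_field_ae_eq hA hY hk hc hf hfi hkf φ (hB j) (hBm j)
  refine ⟨fun j => ae_of_all _ fun ω => integrableOn_mul_inner_fieldVec hk hc φ (Y ω) (hB j),
    fun j => (Lp.memLp _).ae_eq (heq j).symm, ?_⟩
  have h1 : Tendsto (fun j => cylindricalWiener Wdot t (mollify f (restrictLp φ (hBm j)))) atTop
      (𝓝 (cylindricalWiener Wdot t (mollify f φ))) := by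
    simp only [← hW.wienerCLM_apply]
    exact ((hW.wienerCLM t).continuous.tendsto _).comp
      (tendsto_mollify hfi (tendsto_restrictLp φ hmono hBm hU))
  rw [Lp.tendsto_Lp_iff_tendsto_eLpNorm'] at h1
  refine h1.congr fun j => eLpNorm_congr_ae ?_
  filter_upwards [heq j] with ω hω
  rw [hω, Pi.sub_apply]

end SpatialIntegral

end CylWiener

/-! ### Construction of the field and verification of its properties -/

theorem mainTheorem3 {Ω : Type*} {mΩ : MeasurableSpace Ω} (P : Measure Ω) [IsProbabilityMeasure P]
    (T : ℝ≥0) (hT : 0 < T) (d : ℕ)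
    (Wdot : SpaceTimeL2 T d → Lp ℝ 2 P) (hW : IsSpaceTimeWhiteNoise P Wdot)
    (ρ : Space d → ℝ) (hρ : IsMollifierKernel ρ) :
    ∃ (ℱ : Filtration (Time T) mΩ) (X : ℕ+ → Time T → Space d → Ω → ℝ),
      -- `X` is a version of the mollified cylindrical Wiener processes
      (∀ n t x, X n t x =ᵐ[P] mollifiedWiener Wdot hρ n t x) ∧
      IsGoodWeakApproximation ℱ (cylindricalWiener Wdot) X ∧
      (∀ (n : ℕ+) x, IsBrownianMotionWithQV P ℱ ((∫ y, ρ y ^ 2).toNNReal * (n : ℝ≥0) ^ d)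
        fun t => X n t x) ∧
      ∀ (t : Time T) (φ : SpaceL2 d),
        (∃ K : Set (Space d), IsCompact K ∧ ∀ᵐ x, x ∉ K → φ x = 0) →
        (∀ n, ∀ᵐ ω ∂P, Integrable fun x => φ x * X n t x ω) ∧
        ∀ᵐ ω ∂P, Tendsto (fun n => ∫ x, φ x * X n t x ω) atTop
          (𝓝 (cylindricalWiener Wdot t φ ω)) := by
  obtain ⟨A, hA, V, hV⟩ := exists_smoothingOperator d
  obtain ⟨w, b, hb⟩ := exists_hilbertBasis ℝ (SpaceL2 d)
  obtain ⟨Y, hYm, hYc, hY⟩ := hW.exists_continuous_process A b (hV w b b.orthonormal)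
  choose k hk hc hkf using fun n : ℕ+ =>
    exists_expKernel_convolution (hρ.contDiff_mollifier n) (hρ.hasCompactSupport_mollifier n)
  have hcont : ∀ n, Continuous (mollifier ρ n) := fun n => (hρ.contDiff_mollifier n).continuous
  let X : ℕ+ → Time T → Space d → Ω → ℝ := fun n t x ω =>
    inner ℝ (fieldVec (hk n).continuous (hc n) x) (Y t ω)
  have hX : ∀ n t x, X n t x =ᵐ[P] mollifiedWiener Wdot hρ n t x := fun n t x => by
    have h1 : A (fieldVec (hk n).continuous (hc n) x) = hρ.translate n x :=
      Lp.ext ((smoothing_fieldVec hA (hk n).continuous (hc n) (hkf n) x).trans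
        (hρ.memLp_translate n x).coeFn_toLp.symm)
    rw [mollifiedWiener, ← h1]
    exact hY t _
  have hXc : ∀ n x ω, Continuous fun t => X n t x ω := fun n x ω =>
    continuous_const.inner (hYc ω)
  have hB : ∀ (n : ℕ+) x, IsBrownianMotion P (wienerFiltration P Wdot)
      ((∫ y, ρ y ^ 2).toNNReal * (n : ℝ≥0) ^ d) fun t => X n t x := fun n x => by
    rw [← hρ.norm_translate_sq n x]
    exact hW.isBrownianMotion (fun t => stronglyMeasurable_const.inner (hYm t))
      (fun t => hX n t x) (hXc n x)
  have hQ : ∀ (n : ℕ+) x, IsBrownianMotionWithQV P (wienerFiltration P Wdot)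
      ((∫ y, ρ y ^ 2).toNNReal * (n : ℝ≥0) ^ d) fun t => X n t x := fun n x =>
    ⟨hB n x, (hB n x).hasQuadraticVariation⟩
  refine ⟨wienerFiltration P Wdot, X, hX, ⟨⟨fun n => ⟨fun x => (hB n x).isSemimartingale,
    ae_of_all _ fun ω => ⟨fun t => contDiff_inner_fieldVec (hk n) (hc n) (Y t ω),
      fun x => hXc n x ω⟩⟩, fun φ t => ?_⟩, _, hQ⟩, hQ, fun t φ => ?_⟩
  · refine ⟨fun n => cylindricalWiener Wdot t (mollify (mollifier ρ n) φ), fun n =>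
      isSpatialIntegral_field hW hA (hY t) (hk n).continuous (hc n) (hcont n)
        (hρ.integrable_mollifier n) (hkf n) φ, ?_⟩
    simp only [← hW.wienerCLM_apply]
    exact ((hW.wienerCLM t).continuous.tendsto φ).comp (hρ.tendsto_mollify_mollifier φ)
  · rintro ⟨K, hK, hφ⟩
    have hsupp : ∀ n ω, (fun x => φ x * X n t x ω) =ᵐ[volume]
        K.indicator fun x => φ x * X n t x ω := fun n ω => by
      filter_upwards [hφ] with x hx
      by_cases h : x ∈ K
      · rw [Set.indicator_of_mem h]
      · rw [Set.indicator_of_notMem h, hx h, zero_mul]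
    -- With the bounded set taken to be `K` itself, the integral over $\mathbf R^d$ is an integral
    -- over `K` and no limit over exhaustions is needed.
    have hres : restrictLp φ hK.measurableSet = φ := by
      apply Lp.ext
      filter_upwards [coeFn_restrictLp φ hK.measurableSet, hφ] with x h1 h2
      rw [h1]
      by_cases h : x ∈ K
      · rw [Set.indicator_of_mem h]
      · rw [Set.indicator_of_notMem h, h2 h]
    refine ⟨fun n => ae_of_all _ fun ω => ?_, ?_⟩
    · exact ((integrable_indicator_iff hK.measurableSet).2 (integrableOn_mul_inner_fieldVec
        (hk n).continuous (hc n) φ (Y t ω) hK.isBounded)).congr (hsupp n ω).symm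
    · have hI : ∀ n : ℕ+, (fun ω => ∫ x, φ x * X n t x ω) =ᵐ[P]
          cylindricalWiener Wdot t (mollify (mollifier ρ n) φ) := fun n => by
        have h1 := setIntegral_field_ae_eq hA (hY t) (hk n).continuous (hc n) (hcont n)
          (hρ.integrable_mollifier n) (hkf n) φ hK.isBounded hK.measurableSet
        rw [hres] at h1
        refine EventuallyEq.trans (ae_of_all _ fun ω => ?_) h1
        simp only
        rw [integral_congr_ae (hsupp n ω), integral_indicator hK.measurableSet]
      filter_upwards [hW.ae_tendsto_cylindricalWiener_mollify hρ t φ hK hφ,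
        ae_all_iff.2 hI] with ω h1 h2
      simp only [h2]
      exact h1
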